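/- **Corollary (decentralized policy evaluation).** There is an absolute constant $C>0$ such that the following holds. *Network.* Let $N\ge 2$ agents be the nodes of a connected simple undirected graph, with neighbour sets $\mathcal N_i$, and let $L\in\mathbb R^{N\times N}$ be a gossip matrix: symmetric, positive semi-definite, $L_{i,j}\neq 0$ only if $i=j$ or $j\in\mathcal N_i$, and $\ker L$ is the set of constant vectors. Let $0=\lambda_N(L)<\lambda_{N-1}(L)\le\dots\le\lambda_1(L)$ be its eigenvalues and $\kappa:=\lambda_1(L)/\lambda_{N-1}(L)$. *Markov reward process.* Let $P\in\mathbb R^{n\times n}$ be a row-stochastic matrix, $\gamma\in[0,1)$ a discount factor, $r_1,\dots,r_N\in\mathbb R^n$ reward vectors, $\bar r:=\frac1N\sum_i r_i$, and $r_{\max}$ a number with $\|\bar r\|_\infty\le r_{\max}$. Let $J^*(s):=\mathbb E\big[\sum_{t\ge0}\gamma^t\,\bar r_{s_t}\,\big|\,s_0=s\big]$, where $s_{t+1}\sim P(s_t,\cdot)$. *Generative model.* At each time $t\ge0$ and for each state $j$, all agents observe a common random next state $X_{t,j}\sim P(j,\cdot)$; for each $j$ the $X_{t,j}$, $t\ge0$,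 are independent. Agent $i$ moreover observes a random vector $R_{i,t}\in\mathbb R^n$ whose $j$-th entry has mean $r_{i,j}$ and finite variance $\sigma_{i,j}^2$; the vectors $R_{i,t}$ are independent across agents and time. *Estimates.* For $T\ge1$ run the stochastic dual accelerated algorithm (SDA) with $T_0=\lfloor T/2\rfloor$, $\eta=1/\lambda_1(L)$ and $\zeta=\frac{\sqrt{\kappa}-1}{\sqrt{\kappa}+1}$: start from $x_{i,0}=y_{i,0}=0$ and for $t=0,\dots,T-1$ set $$\theta_{i,t}=x_{i,t}+R_{i,t},\qquad y_{i,t+1}=x_{i,t}-\eta\sum_{j\in\mathcal N_i\cup\{i\}}L_{i,j}\,\theta_{j,t},\qquad x_{i,t+1}=y_{i,t+1}+\zeta\,(y_{i,t+1}-y_{i,t}).$$ Let $\hat r_{i,T}:=\frac1{T-T_0}\sum_{t=T_0}^{T-1}\theta_{i,t}$, let $\hat P_T(j,k):=\frac1T\sum_{t=0}^{T-1}\mathbf 1\{X_{t,j}=k\}$, and let $\hat J_{i,T}:=(I-\gamma\hat P_T)^{-1}\hat r_{i,T}$. *Conclusion.* The random variable $\max_i\|\hat J_{i,T}-J^*\|_\infty$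 is integrable, and for every $T\ge1$ $$\mathbb E\Big[\max_i\|\hat J_{i,T}-J^*\|_\infty\Big]\le C\Bigg(e^{-\frac{T}{2\sqrt{\kappa}}}\,\frac{\sqrt{\sum_i\|r_i-\bar r\|_2^2}}{1-\gamma}+\frac{\kappa^{1/4}\sqrt{\sum_i\sum_j\sigma_{i,j}^2}}{(1-\gamma)T}+\frac{\sqrt{\sum_j\max_i\sigma_{i,j}^2}}{(1-\gamma)\sqrt T}+\frac{r_{\max}\sqrt{\log n}}{(1-\gamma)^{3/2}\sqrt T}+\frac{r_{\max}\log n}{(1-\gamma)^2T}\Bigg).$$ In particular, for rewards normalized so that $\|\bar r\|_\infty\le1$, the factor $r_{\max}$ can be replaced by $1$. -/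

import Mathlib

open MeasureTheory ProbabilityTheory

namespace SDA

/-! ### Gossip matrices -/

/-- `L` is a gossip matrix for the network `G`: it is symmetric and positive semi-definite (over `ℝ`
`Matrix.PosSemidef` includes the symmetry), it is supported on the diagonal and the edges, and its
kernel is the set of constant vectors. -/
structure IsGossipMatrix {N : ℕ} (G : SimpleGraph (Fin N)) (L : Matrix (Fin N) (Fin N) ℝ) :
    Prop where
  posSemidef : L.PosSemidef
  support : ∀ i j, L i j ≠ 0 → i = j ∨ G.Adj i j
  ker : ∀ v : Fin N → ℝ, L.mulVec v = 0 ↔ ∃ c : ℝ, v = fun _ => c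

/-- The eigenvalues, with multiplicity, of a symmetric matrix in decreasing order, numbered from
`0`: `spec hL k` is `λ_{k+1}(L)` where `λ_1(L) ≥ λ_2(L) ≥ ⋯ ≥ λ_N(L)`. -/
noncomputable def spec {N : ℕ} {L : Matrix (Fin N) (Fin N) ℝ} (hL : L.IsHermitian) (k : Fin N) :
    ℝ :=
  hL.eigenvalues₀ (Fin.cast (Fintype.card_fin N).symm k)

/-- The largest eigenvalue `λ_1(L)`. -/
noncomputable def lambdaOne {N : ℕ} {L : Matrix (Fin N) (Fin N) ℝ} (hL : L.IsHermitian)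
    (hN : 2 ≤ N) : ℝ :=
  spec hL ⟨0, by omega⟩

/-- The condition number `κ(L) = λ_1(L) / λ_{N-1}(L)`. -/
noncomputable def kappa {N : ℕ} {L : Matrix (Fin N) (Fin N) ℝ} (hL : L.IsHermitian)
    (hN : 2 ≤ N) : ℝ :=
  lambdaOne hL hN / spec hL ⟨N - 2, by omega⟩

/-! ### The stochastic dual accelerated algorithm -/

section Algorithm

variable {N n : ℕ} (G : SimpleGraph (Fin N)) [DecidableRel G.Adj]
  (L : Matrix (Fin N) (Fin N) ℝ) (η ζ : ℝ) (R : Fin N → ℕ → Fin n → ℝ)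

/-- One communication round: agent `i` computes `y_{i,t+1} = x_{i,t} - η ∑_j L_{i,j} θ_{j,t}`, the
sum being over its neighbours and itself. -/
def gossipStep (x θ : Fin N → Fin n → ℝ) (i : Fin N) : Fin n → ℝ :=
  x i - η • ∑ j ∈ insert i (G.neighborFinset i), L i j • θ j

/-- The state `(x_t, y_t)` of all agents at time `t`, when agent `i` observes the vector `R i t` at
time `t`. -/
def state : ℕ → (Fin N → Fin n → ℝ) × (Fin N → Fin n → ℝ)
  | 0 => (0, 0)
  | t + 1 =>
    let x := (state t).1
    let y := (state t).2
    let y' := gossipStep G L η x (fun j => x j + R j t)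
    (fun i => y' i + ζ • (y' i - y i), y')

/-- The local update `θ_{i,t} = x_{i,t} + R_{i,t}`. -/
def theta (i : Fin N) (t : ℕ) : Fin n → ℝ :=
  (state G L η ζ R t).1 i + R i t

/-- The output of agent `i` after `T` iterations with burn-in time `T₀`. -/
noncomputable def output (T₀ T : ℕ) (i : Fin N) : Fin n → ℝ :=
  ((T : ℝ) - (T₀ : ℝ))⁻¹ • ∑ t ∈ Finset.Ico T₀ T, theta G L η ζ R i t

end Algorithm

/-- The output of agent `i` with the tuned parameters: burn-in time `⌊T / 2⌋`, step-size
`η = 1 / λ_1(L)` and momentum `ζ = (√κ(L) - 1) / (√κ(L) + 1)`. -/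
noncomputable def tunedOutput {N n : ℕ} (G : SimpleGraph (Fin N)) [DecidableRel G.Adj]
    {L : Matrix (Fin N) (Fin N) ℝ} (hL : L.IsHermitian) (hN : 2 ≤ N)
    (R : Fin N → ℕ → Fin n → ℝ) (T : ℕ) (i : Fin N) : Fin n → ℝ :=
  output G L (1 / lambdaOne hL hN)
    ((Real.sqrt (kappa hL hN) - 1) / (Real.sqrt (kappa hL hN) + 1)) R (T / 2) T i

/-! ### Markov reward processes -/

section MRP

variable {n : ℕ} {P : Matrix (Fin n) (Fin n) ℝ}

/-- The distribution `P(s, ·)` of the state that follows `s`. -/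
noncomputable def nextState (hP : P ∈ Matrix.rowStochastic ℝ (Fin n)) (s : Fin n) : PMF (Fin n) :=
  PMF.ofFintype (fun k => ENNReal.ofReal (P s k)) (by
    rw [← ENNReal.ofReal_sum_of_nonneg (fun k _ => (Matrix.mem_rowStochastic.1 hP).1 s k)]
    have h := congrFun (Matrix.mem_rowStochastic.1 hP).2 s
    simp only [Matrix.mulVec, dotProduct, Pi.one_apply, mul_one] at h
    rw [h, ENNReal.ofReal_one])

/-- The transition kernel at time `t`: given the states up to time `t`, the next state has
distribution `P(s_t, ·)`. -/
noncomputable def stepKernel (hP : P ∈ Matrix.rowStochastic ℝ (Fin n)) (t : ℕ) :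
    Kernel (Π _ : Finset.Iic t, Fin n) (Fin n) :=
  (Kernel.ofFunOfCountable fun s => (nextState hP s).toMeasure).comap
    (fun h => h ⟨t, Finset.mem_Iic.2 le_rfl⟩) (measurable_pi_apply _)

instance (hP : P ∈ Matrix.rowStochastic ℝ (Fin n)) (t : ℕ) : IsMarkovKernel (stepKernel hP t) := by
  refine ⟨fun h => ?_⟩
  simp only [stepKernel, Kernel.comap_apply]
  exact PMF.toMeasure.isProbabilityMeasure (nextState hP (h ⟨t, Finset.mem_Iic.2 le_rfl⟩))

/-- The law of the trajectory `s_0, s_1, …` of the Markov chain with transition matrix `P` started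
at `s_0 = s`. -/
noncomputable def chainLaw (hP : P ∈ Matrix.rowStochastic ℝ (Fin n)) (s : Fin n) :
    Measure (ℕ → Fin n) :=
  Kernel.traj (X := fun _ => Fin n) (stepKernel hP) 0 (fun _ => s)

/-- The value function `J(s) = 𝔼[∑_t γ^t r(s_t) | s_0 = s]`. -/
noncomputable def valueFunction (hP : P ∈ Matrix.rowStochastic ℝ (Fin n)) (γ : ℝ)
    (r : Fin n → ℝ) (s : Fin n) : ℝ :=
  ∫ x, ∑' t : ℕ, γ ^ t * r (x t) ∂(chainLaw hP s)

end MRP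

/-- The average `r̄ = (1/N) ∑_i r_i` of the reward vectors. -/
noncomputable def avg {N n : ℕ} (r : Fin N → Fin n → ℝ) : Fin n → ℝ :=
  (N : ℝ)⁻¹ • ∑ i, r i

/-! ### The generative model and the plug-in estimator -/

/-- The generative model. `X t j` is the next state sampled from `P(j, ·)` at time `t`, common to all
agents; the samples are independent across time. `R i t` is the random reward vector of agent `i` at
time `t`; its `j`-th entry has mean `r i j` and variance `σ i j ^ 2`, and the reward vectors are
independent across agents and time. Neither the samples for different states nor rewards and next
states need to be independent of each other. -/
structure IsGenerativeModel {N n : ℕ} {Ω : Type*} [MeasurableSpace Ω] (μ : Measure Ω)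
    (P : Matrix (Fin n) (Fin n) ℝ) (r σ : Fin N → Fin n → ℝ)
    (X : ℕ → Fin n → Ω → Fin n) (R : Fin N → ℕ → Ω → Fin n → ℝ) : Prop where
  measurable_next : ∀ t j, Measurable (X t j)
  law_next : ∀ t j k, μ (X t j ⁻¹' {k}) = ENNReal.ofReal (P j k)
  indep_next : ∀ j, iIndepFun (fun t => X t j) μ
  measurable_reward : ∀ i t, Measurable (R i t)
  memLp_reward : ∀ i t j, MemLp (fun ω => R i t ω j) 2 μ
  mean_reward : ∀ i t j, ∫ ω, R i t ω j ∂μ = r i j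
  variance_reward : ∀ i t j, variance (fun ω => R i t ω j) μ = σ i j ^ 2
  indep_reward : iIndepFun (fun p : Fin N × ℕ => R p.1 p.2) μ

/-- The empirical transition matrix after `T` samples per state. -/
noncomputable def empiricalP {n : ℕ} (X : ℕ → Fin n → Fin n) (T : ℕ) :
    Matrix (Fin n) (Fin n) ℝ :=
  Matrix.of fun j k => (T : ℝ)⁻¹ * ∑ t ∈ Finset.range T, if X t j = k then 1 else 0

/-- The plug-in estimate `(I - γ P̂)⁻¹ r̂` (for `0 ≤ γ < 1` and a row-stochastic `P̂` the matrix
`I - γ P̂` is always invertible). -/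
noncomputable def plugIn {n : ℕ} (γ : ℝ) (Phat : Matrix (Fin n) (Fin n) ℝ) (rhat : Fin n → ℝ) :
    Fin n → ℝ :=
  ((1 - γ • Phat)⁻¹).mulVec rhat

end SDA

/-! The error splits pathwise: with the same random matrix P̂, the estimate minus J* is `plugIn` of
(r̂ᵢ - r̄) plus the difference between the value of r̄ under P̂ and under P. The resolvent of a
stochastic matrix has sup-norm at most 1/(1-γ), so the two pieces are bounded separately and no
independence between rewards and transitions is needed.

Reward part. In an eigenbasis of L the algorithm decouples into scalar recursions
(`sum_mul_output`). In each mode the accumulated θ is the convolution of the input with a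
`stepResponse` f (`sum_theta_eq_convolution`). In the constant mode f = 1, so the output there is an
ordinary average of the inputs after burn-in, which gives the 1/√T term. In the other modes, with q
= 1/√κ, the tuned momentum gives |f(t)| ≤ 2(1+qt)(1-q)^t (`abs_stepResponse_le`). The average of f
over the second half of the run, which is the bias, is therefore of order (1-q)^(T/2). The sum of
f², which governs the noise, is O(√κ) uniformly in T, so this noise contributes only κ^(1/4)/T after
division by the window length. Parseval adds up the modes (`exists_sq_error_bound`).

Transition part. The error is the resolvent of P̂ applied to γ(P̂-P)J. Bernstein bounds this by the
standard deviation of J at the next state. A sup bound on that deviation would cost (1-γ)^(-2);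
instead, the resolvent applied to the one-step variances is controlled by a Bellman-type inequality
for J², and Jensen passes to standard deviations, which yields (1-γ)^(-3/2) (`abs_plugIn_sub_le`).
The argument uses P̂ in place of P, so Bernstein is needed for J² too. All 2n deviations are
expressed through one random level whose mean is at most log(4n)+1 (`integral_iSup_le_log_of_tail`).
-/

namespace SDA

/-! ### The step response of one mode -/

/-- The step response of `θ` in the mode `h` of the accelerated recursion with momentum `ζ`. -/
noncomputable def stepResponse (h ζ : ℝ) : ℕ → ℝ
  | 0 => 1
  | 1 => (1 - h) * (1 + ζ) - ζ
  | t + 2 => (1 - h) * (1 + ζ) * stepResponse h ζ (t + 1) - (1 - h) * ζ * stepResponse h ζ t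

/-- A Cassini-type identity: the quadratic form of the characteristic polynomial is multiplied by
the product of the roots at each step. It replaces the closed formula in complex roots. -/
lemma stepResponse_energy (h ζ : ℝ) (t : ℕ) :
    stepResponse h ζ (t + 1) ^ 2
        - (1 - h) * (1 + ζ) * stepResponse h ζ (t + 1) * stepResponse h ζ t
        + (1 - h) * ζ * stepResponse h ζ t ^ 2
      = ((1 - h) * ζ) ^ t * (h * ζ ^ 2) := by
  induction t with
  | zero => simp only [stepResponse]; ring
  | succ t ih =>
    have h1 : ((1 - h) * ζ) ^ (t + 1) * (h * ζ ^ 2)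
        = (1 - h) * ζ * (((1 - h) * ζ) ^ t * (h * ζ ^ 2)) := by ring
    rw [h1, ← ih]
    simp only [stepResponse]; ring

lemma stepResponse_zero_mode (ζ : ℝ) (t : ℕ) : stepResponse 0 ζ t = 1 := by
  induction t using Nat.strong_induction_on with
  | _ t ih =>
    match t with
    | 0 => rfl
    | 1 => simp [stepResponse]
    | t + 2 => simp only [stepResponse, ih (t + 1) (by omega), ih t (by omega)]; ring

section Tuned

variable {q h ζ : ℝ}

lemma momentum_bounds (hq : 0 < q) (hq1 : q ≤ 1) (hζ : ζ = (1 - q) / (1 + q)) :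
    0 ≤ ζ ∧ ζ ≤ 1 - q ∧ (1 + q) * ζ = 1 - q := by
  have h3 : (1 + q) * ζ = 1 - q := by rw [hζ]; field_simp
  have h0 : 0 ≤ ζ := by rw [hζ]; apply div_nonneg <;> linarith
  exact ⟨h0, by nlinarith, h3⟩

lemma root_sq_le (hq : 0 < q) (hq1 : q ≤ 1) (hζ : ζ = (1 - q) / (1 + q)) (hl : q ^ 2 ≤ h) :
    (1 - h) * ζ ≤ (1 - q) ^ 2 := by
  obtain ⟨h0, h1, h2⟩ := momentum_bounds hq hq1 hζ
  calc (1 - h) * ζ ≤ (1 - q ^ 2) * ζ := by gcongr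
    _ = (1 - q) * ((1 + q) * ζ) := by ring
    _ = (1 - q) ^ 2 := by rw [h2]; ring

lemma half_trace_le (hq : 0 < q) (hq1 : q ≤ 1) (hζ : ζ = (1 - q) / (1 + q)) (hl : q ^ 2 ≤ h) :
    (1 - h) * (1 + ζ) / 2 ≤ 1 - q := by
  obtain ⟨h0, h1, h2⟩ := momentum_bounds hq hq1 hζ
  calc (1 - h) * (1 + ζ) / 2 ≤ (1 - q ^ 2) * (1 + ζ) / 2 := by gcongr
    _ = (1 - q) * ((1 + q) + (1 + q) * ζ) / 2 := by ring
    _ = 1 - q := by rw [h2]; ring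

/-- The tuned momentum makes h = q² critically damped. For q² ≤ h ≤ 1 the roots are complex or
double, so the energy form is positive semidefinite. -/
lemma discriminant_eq (hq : 0 < q) (hq1 : q ≤ 1) (hζ : ζ = (1 - q) / (1 + q)) :
    (1 + q) ^ 2 * ((1 - h) * ζ - ((1 - h) * (1 + ζ) / 2) ^ 2) = (1 - h) * (h - q ^ 2) := by
  obtain ⟨h0, h1, h2⟩ := momentum_bounds hq hq1 hζ
  have : (1 + q) ^ 2 * ((1 - h) * ζ - ((1 - h) * (1 + ζ) / 2) ^ 2)
    = (1 - h) * ((1 + q) * ((1 + q) * ζ) - (1 - h) * ((1 + q) + (1 + q) * ζ) ^ 2 / 4) := by ring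
  rw [this, h2]; ring

/-- Near critical damping the energy form degenerates and only controls f(t+1) - c·f(t), with c half
the trace. Iterating this first-order recursion produces the factor linear in t. -/
lemma abs_stepResponse_le_of_small (hq : 0 < q) (hq1 : q ≤ 1) (hζ : ζ = (1 - q) / (1 + q))
    (hl : q ^ 2 ≤ h) (hu : h ≤ 1) (hs : h ≤ 2 * q ^ 2) (t : ℕ) :
    |stepResponse h ζ t| ≤ (1 + 2 * (q * t)) * (1 - q) ^ t := by
  obtain ⟨h0, h1, h2⟩ := momentum_bounds hq hq1 hζ
  have hp : 0 ≤ 1 - q := by linarith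
  have hc0 : 0 ≤ (1 - h) * (1 + ζ) / 2 := by
    have : 0 ≤ 1 - h := by linarith
    positivity
  have hD : 0 ≤ (1 - h) * ζ - ((1 - h) * (1 + ζ) / 2) ^ 2 := by
    have h4 := discriminant_eq (h := h) hq hq1 hζ
    have h5 : 0 ≤ (1 - h) * (h - q ^ 2) := mul_nonneg (by linarith) (by linarith)
    rw [← h4] at h5
    exact nonneg_of_mul_nonneg_right h5 (by positivity)
  induction t with
  | zero => simp [stepResponse]
  | succ t ih =>
    have hE := stepResponse_energy h ζ t
    have hpow : ((1 - h) * ζ) ^ t * (h * ζ ^ 2) ≤ ((1 - q) ^ t * (2 * q * (1 - q))) ^ 2 := by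
      calc ((1 - h) * ζ) ^ t * (h * ζ ^ 2)
          ≤ ((1 - q) ^ 2) ^ t * ((2 * q ^ 2) * (1 - q) ^ 2) := by
            have : 0 ≤ 1 - h := by linarith
            have : 0 ≤ h := (sq_nonneg q).trans hl
            gcongr
            exact root_sq_le hq hq1 hζ hl
        _ ≤ ((1 - q) ^ 2) ^ t * ((4 * q ^ 2) * (1 - q) ^ 2) := by gcongr; norm_num
        _ = ((1 - q) ^ t * (2 * q * (1 - q))) ^ 2 := by rw [pow_right_comm]; ring
    -- Complete the square in f(t+1) and drop the nonnegative remainder, the discriminant times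
    -- f(t)².
    have hsq : (stepResponse h ζ (t + 1) - (1 - h) * (1 + ζ) / 2 * stepResponse h ζ t) ^ 2
        ≤ ((1 - q) ^ t * (2 * q * (1 - q))) ^ 2 := by
      refine le_trans ?_ hpow
      rw [← hE]
      nlinarith [mul_nonneg hD (sq_nonneg (stepResponse h ζ t))]
    have habs := abs_le_of_sq_le_sq hsq (by positivity)
    calc |stepResponse h ζ (t + 1)|
        = |(stepResponse h ζ (t + 1) - (1 - h) * (1 + ζ) / 2 * stepResponse h ζ t)
          + (1 - h) * (1 + ζ) / 2 * stepResponse h ζ t| := by ring_nf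
      _ ≤ (1 - q) ^ t * (2 * q * (1 - q)) + (1 - q) * ((1 + 2 * (q * t)) * (1 - q) ^ t) := by
          refine (abs_add_le _ _).trans (add_le_add habs ?_)
          rw [abs_mul, abs_of_nonneg hc0]
          gcongr
          exact half_trace_le hq hq1 hζ hl
      _ = _ := by push_cast; ring

/-- Away from critical damping h - q² ≥ h/2, so the energy controls f(t+1)² itself. The factor h in
the initial energy cancels, leaving no polynomial factor. -/
lemma abs_stepResponse_le_of_large (hq : 0 < q) (hq1 : q ≤ 1) (hζ : ζ = (1 - q) / (1 + q))
    (hu : h < 1) (hs : 2 * q ^ 2 ≤ h) (t : ℕ) :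
    |stepResponse h ζ t| ≤ 2 * (1 - q) ^ t := by
  obtain ⟨h0, h1, h2⟩ := momentum_bounds hq hq1 hζ
  have hp : 0 ≤ 1 - q := by linarith
  have hh : 0 < h := by nlinarith [pow_pos hq 2]
  have hl : q ^ 2 ≤ h := by nlinarith
  cases t with
  | zero => simp [stepResponse]
  | succ t =>
    have hE := stepResponse_energy h ζ t
    have hdisc := discriminant_eq (h := h) hq hq1 hζ
    set f := stepResponse h ζ (t + 1)
    set g := stepResponse h ζ t
    set E := ((1 - h) * ζ) ^ t with hEdef
    have h1h : 0 < 1 - h := by linarith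
    have hE0 : 0 ≤ E := by positivity
    have hEle : E ≤ ((1 - q) ^ 2) ^ t := by
      rw [hEdef]; gcongr; exact root_sq_le hq hq1 hζ hl
    have key : (1 - h) * (h - q ^ 2) * f ^ 2
        ≤ (1 - h) * (h * (E * ((1 - q) ^ 2 * ζ))) := by
      -- The square is now completed in g, after multiplying the energy by the product of the roots.
      have h6 : ((1 - h) * ζ - ((1 - h) * (1 + ζ) / 2) ^ 2) * f ^ 2
          ≤ (1 - h) * ζ * (E * (h * ζ ^ 2)) := by
        rw [← hE]
        nlinarith [sq_nonneg ((1 - h) * ζ * g - (1 - h) * (1 + ζ) / 2 * f)]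
      calc (1 - h) * (h - q ^ 2) * f ^ 2
          = (1 + q) ^ 2 * (((1 - h) * ζ - ((1 - h) * (1 + ζ) / 2) ^ 2) * f ^ 2) := by
            rw [← hdisc]; ring
        _ ≤ (1 + q) ^ 2 * ((1 - h) * ζ * (E * (h * ζ ^ 2))) := by gcongr
        _ = (1 - h) * (h * (E * (((1 + q) * ζ) ^ 2 * ζ))) := by ring
        _ = _ := by rw [h2]
    have key2 : (h / 2) * f ^ 2 ≤ h * (E * ((1 - q) ^ 2 * ζ)) := by
      have h7 : (h - q ^ 2) * f ^ 2 ≤ h * (E * ((1 - q) ^ 2 * ζ)) := by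
        refine le_of_mul_le_mul_left ?_ h1h
        rw [← mul_assoc]; exact key
      refine le_trans ?_ h7
      gcongr; linarith
    have key3 : f ^ 2 ≤ 2 * (E * ((1 - q) ^ 2 * ζ)) := by
      refine le_of_mul_le_mul_left ?_ (half_pos hh)
      linarith
    refine abs_le_of_sq_le_sq (key3.trans ?_) (by have := pow_nonneg hp (t + 1); positivity)
    calc 2 * (E * ((1 - q) ^ 2 * ζ)) ≤ 4 * (((1 - q) ^ 2) ^ t * ((1 - q) ^ 2 * 1)) := by
          gcongr <;> linarith
      _ = _ := by rw [pow_right_comm]; ring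

lemma abs_stepResponse_le (hq : 0 < q) (hq1 : q ≤ 1) (hζ : ζ = (1 - q) / (1 + q))
    (hl : q ^ 2 ≤ h) (hu : h ≤ 1) (t : ℕ) :
    |stepResponse h ζ t| ≤ 2 * ((1 + q * t) * (1 - q) ^ t) := by
  have hp : 0 ≤ 1 - q := by linarith
  rcases le_total h (2 * q ^ 2) with hs | hs
  · refine (abs_stepResponse_le_of_small hq hq1 hζ hl hu hs t).trans ?_
    have : 0 ≤ (1 - q) ^ t := pow_nonneg hp t
    nlinarith
  rcases hu.lt_or_eq with hlt | rfl
  · refine (abs_stepResponse_le_of_large hq hq1 hζ hlt hs t).trans ?_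
    gcongr
    have : 0 ≤ q * t := by positivity
    nlinarith [pow_nonneg hp t]
  -- At h = 1 the energy argument would divide by 1 - h = 0, but the recursion vanishes from time 2
  -- on.
  · obtain ⟨h0, h1, h2⟩ := momentum_bounds hq hq1 hζ
    match t with
    | 0 => simp [stepResponse]
    | 1 =>
      simp only [stepResponse, sub_self, zero_mul, zero_sub, abs_neg, abs_of_nonneg h0]
      push_cast
      nlinarith
    | t + 2 =>
      simp only [stepResponse, sub_self, zero_mul, abs_zero]
      positivity

lemma sum_one_sub_pow_le (hq : 0 < q) (hq1 : q ≤ 1) (T : ℕ) :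
    ∑ t ∈ Finset.range T, (1 - q) ^ t ≤ 1 / q := by
  have h1 := mul_neg_geom_sum (1 - q) T
  rw [le_div_iff₀ hq, mul_comm]
  have : 0 ≤ (1 - q) ^ T := pow_nonneg (by linarith) T
  linarith

/-- Half of the decay rate pays for the linear factor. This is affordable for the noise, where only
the order of the sum of squares matters, but not for the bias, whose exponent must be kept. -/
lemma one_add_mul_pow_le (hq : 0 < q) (hq1 : q ≤ 1) (t : ℕ) :
    (1 + q * t) * (1 - q) ^ t ≤ 2 * (1 - q / 2) ^ t := by
  have hb := one_add_mul_le_pow (a := q / 2) (by linarith) t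
  have hp : 0 ≤ 1 - q := by linarith
  calc (1 + q * t) * (1 - q) ^ t ≤ (2 * (1 + q / 2) ^ t) * (1 - q) ^ t := by
        gcongr; linarith
    _ = 2 * ((1 + q / 2) * (1 - q)) ^ t := by rw [mul_pow]; ring
    _ ≤ _ := by gcongr; nlinarith

lemma sum_stepResponse_sq_le (hq : 0 < q) (hq1 : q ≤ 1) (hζ : ζ = (1 - q) / (1 + q))
    (hl : q ^ 2 ≤ h) (hu : h ≤ 1) (T : ℕ) :
    ∑ t ∈ Finset.range T, stepResponse h ζ t ^ 2 ≤ 32 / q := by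
  calc ∑ t ∈ Finset.range T, stepResponse h ζ t ^ 2
      ≤ ∑ t ∈ Finset.range T, 16 * (1 - q / 2) ^ t := by
        refine Finset.sum_le_sum fun t _ => ?_
        have h1 := abs_stepResponse_le hq hq1 hζ hl hu t
        have h2 := one_add_mul_pow_le hq hq1 t
        have hp : 0 ≤ 1 - q / 2 := by linarith
        calc stepResponse h ζ t ^ 2 = |stepResponse h ζ t| ^ 2 := (sq_abs _).symm
          _ ≤ (4 * (1 - q / 2) ^ t) ^ 2 := by gcongr; linarith
          _ = 16 * ((1 - q / 2) ^ t * (1 - q / 2) ^ t) := by ring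
          _ ≤ 16 * ((1 - q / 2) ^ t * 1) := by
              gcongr; exact pow_le_one₀ hp (by linarith)
          _ = _ := by ring
    _ = 16 * ∑ t ∈ Finset.range T, (1 - q / 2) ^ t := by rw [Finset.mul_sum]
    _ ≤ 16 * (1 / (q / 2)) := by gcongr; exact sum_one_sub_pow_le (by linarith) (by linarith) T
    _ = 32 / q := by field_simp; norm_num

/-- The full rate survives the factor 1 + qt thanks to averaging: the dangerous part q·T₀ is
multiplied by a geometric sum of size 1/q, giving T₀, which is at most the window length. -/
lemma abs_sum_stepResponse_le (hq : 0 < q) (hq1 : q ≤ 1) (hζ : ζ = (1 - q) / (1 + q))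
    (hl : q ^ 2 ≤ h) (hu : h ≤ 1) {T₀ T : ℕ} (hT : T₀ ≤ T - T₀) :
    |∑ t ∈ Finset.Ico T₀ T, stepResponse h ζ t| ≤ ((T - T₀ : ℕ) : ℝ) * (4 * (1 - q) ^ T₀) := by
  have hp : 0 ≤ 1 - q := by linarith
  set m := T - T₀
  rw [Finset.sum_Ico_eq_sum_range]
  have hterm : ∀ u ∈ Finset.range m, |stepResponse h ζ (T₀ + u)|
      ≤ 2 * (1 - q) ^ T₀ * (1 + m * (q * (1 - q) ^ u)) := by
    intro u _
    refine (abs_stepResponse_le hq hq1 hζ hl hu _).trans ?_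
    have h1 : (1 + q * u) * (1 - q) ^ u ≤ 1 := by
      have hb := one_add_mul_le_pow (a := q) (by linarith) u
      calc (1 + q * u) * (1 - q) ^ u ≤ (1 + q) ^ u * (1 - q) ^ u := by gcongr; linarith
        _ = ((1 + q) * (1 - q)) ^ u := by rw [mul_pow]
        _ ≤ 1 := pow_le_one₀ (mul_nonneg (by linarith) hp) (by nlinarith)
    have h2 : (T₀ : ℝ) * (q * (1 - q) ^ u) ≤ m * (q * (1 - q) ^ u) := by gcongr
    calc 2 * ((1 + q * ((T₀ + u : ℕ) : ℝ)) * (1 - q) ^ (T₀ + u))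
        = 2 * (1 - q) ^ T₀ * ((1 + q * u) * (1 - q) ^ u + T₀ * (q * (1 - q) ^ u)) := by
          push_cast; ring
      _ ≤ _ := by gcongr
  refine (Finset.abs_sum_le_sum_abs _ _).trans ((Finset.sum_le_sum hterm).trans ?_)
  rw [← Finset.mul_sum, Finset.sum_add_distrib, ← Finset.mul_sum, ← Finset.mul_sum]
  have h3 := sum_one_sub_pow_le hq hq1 m
  have h4 : q * ∑ t ∈ Finset.range m, (1 - q) ^ t ≤ 1 := by
    rw [le_div_iff₀ hq] at h3; linarith
  simp only [Finset.sum_const, Finset.card_range, nsmul_eq_mul, mul_one]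
  calc 2 * (1 - q) ^ T₀ * (m + m * (q * ∑ t ∈ Finset.range m, (1 - q) ^ t))
      ≤ 2 * (1 - q) ^ T₀ * (m + m * 1) := by gcongr
    _ = _ := by ring

/-- The floor in T/2 costs at most exp(q/2) ≤ 2. -/
lemma one_sub_pow_half_le (hq : 0 < q) (hq1 : q ≤ 1) (T : ℕ) :
    (1 - q) ^ (T / 2) ≤ 2 * Real.exp (-(T : ℝ) * q / 2) := by
  have hT : (T : ℝ) ≤ 2 * ((T / 2 : ℕ) : ℝ) + 1 := by
    have : T ≤ 2 * (T / 2) + 1 := by omega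
    exact_mod_cast this
  have h2 : Real.exp (q / 2) ≤ 2 := by
    calc Real.exp (q / 2) ≤ Real.exp (1 / 2) := by gcongr
      _ ≤ 1 / (1 - 1 / 2) := Real.exp_bound_div_one_sub_of_interval (by norm_num) (by norm_num)
      _ = 2 := by norm_num
  calc (1 - q) ^ (T / 2) ≤ (Real.exp (-q)) ^ (T / 2) := by
        exact pow_le_pow_left₀ (by linarith) (Real.one_sub_le_exp_neg q) _
    _ = Real.exp (((T / 2 : ℕ) : ℝ) * (-q)) := (Real.exp_nat_mul _ _).symm
    _ ≤ Real.exp (q / 2 + -(T : ℝ) * q / 2) := by gcongr; nlinarith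
    _ = Real.exp (q / 2) * Real.exp (-(T : ℝ) * q / 2) := Real.exp_add _ _
    _ ≤ _ := by gcongr

end Tuned

/-! ### Sums of one mode of the recursion -/

/-- The sum of `θ` up to time `T` is a convolution of the input with the step response. -/
lemma sum_theta_eq_convolution {h ζ : ℝ} {x y d : ℕ → ℝ} (hx : x 0 = 0) (hy : y 0 = 0)
    (hys : ∀ t, y (t + 1) = x t - h * (x t + d t))
    (hxs : ∀ t, x (t + 1) = y (t + 1) + ζ * (y (t + 1) - y t)) (T : ℕ) :
    ∑ t ∈ Finset.range T, (x t + d t)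
      = ∑ s ∈ Finset.range T, stepResponse h ζ (T - 1 - s) * d s := by
  -- Eliminating x and y leaves a second-order recursion for the partial sums. Its source term
  -- d(T+1) - ζ·d(T) explains the two initial values of `stepResponse`.
  have hrec : ∀ T, ∑ t ∈ Finset.range (T + 2), (x t + d t)
      = (1 - h) * (1 + ζ) * ∑ t ∈ Finset.range (T + 1), (x t + d t)
        - (1 - h) * ζ * ∑ t ∈ Finset.range T, (x t + d t) + d (T + 1) - ζ * d T := by
    intro T
    induction T with
    | zero =>
      simp [Finset.sum_range_succ, hxs, hys, hx, hy]; ring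
    | succ T ih =>
      have e1 := Finset.sum_range_succ (fun t => x t + d t) (T + 2)
      have e2 := Finset.sum_range_succ (fun t => x t + d t) (T + 1)
      have e3 := Finset.sum_range_succ (fun t => x t + d t) T
      have e4 := hxs (T + 1)
      have e5 := hys (T + 1)
      have e6 := hys T
      rw [e5, e6] at e4
      rw [e1]
      linear_combination ih + e4 - (1 - h) * (1 + ζ) * e2 + (1 - h) * ζ * e3
  induction T using Nat.strong_induction_on with
  | _ T ih =>
    match T with
    | 0 => simp
    | 1 => simp [stepResponse, hx]
    | T + 2 =>
      rw [hrec, ih (T + 1) (by omega), ih T (by omega), Finset.sum_range_succ _ (T + 1),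
        Finset.sum_range_succ _ T, Finset.sum_range_succ _ T]
      have h1 : ∀ s ∈ Finset.range T, stepResponse h ζ (T + 2 - 1 - s) * d s
          = (1 - h) * (1 + ζ) * (stepResponse h ζ (T + 1 - 1 - s) * d s)
            - (1 - h) * ζ * (stepResponse h ζ (T - 1 - s) * d s) := by
        intro s hs
        have hs := Finset.mem_range.1 hs
        obtain ⟨k, rfl⟩ : ∃ k, T = s + 1 + k := ⟨T - (s + 1), by omega⟩
        rw [show s + 1 + k + 2 - 1 - s = k + 2 by omega, show s + 1 + k + 1 - 1 - s = k + 1 by omega,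
          show s + 1 + k - 1 - s = k by omega]
        simp only [stepResponse]; ring
      rw [Finset.sum_congr rfl h1, Finset.sum_sub_distrib, ← Finset.mul_sum, ← Finset.mul_sum]
      rw [show T + 2 - 1 - T = 1 by omega, show T + 2 - 1 - (T + 1) = 0 by omega,
        show T + 1 - 1 - T = 0 by omega]
      simp only [stepResponse]; ring

/-! ### The Bellman equation -/

section Bellman

variable {n : ℕ} {P : Matrix (Fin n) (Fin n) ℝ}

instance (hP : P ∈ Matrix.rowStochastic ℝ (Fin n)) (s : Fin n) :
    IsProbabilityMeasure (chainLaw hP s) := by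
  unfold chainLaw; infer_instance

lemma rowStochastic_nonneg (hP : P ∈ Matrix.rowStochastic ℝ (Fin n)) (i j : Fin n) : 0 ≤ P i j :=
  (Matrix.mem_rowStochastic.1 hP).1 i j

lemma rowStochastic_sum (hP : P ∈ Matrix.rowStochastic ℝ (Fin n)) (i : Fin n) :
    ∑ j, P i j = 1 := by
  have h := congrFun (Matrix.mem_rowStochastic.1 hP).2 i
  simpa [Matrix.mulVec, dotProduct] using h

lemma integral_nextState (hP : P ∈ Matrix.rowStochastic ℝ (Fin n)) (s : Fin n)
    (g : Fin n → ℝ) : ∫ k, g k ∂(nextState hP s).toMeasure = P.mulVec g s := by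
  rw [PMF.integral_eq_sum]
  simp only [Matrix.mulVec, dotProduct, nextState, PMF.ofFintype_apply, smul_eq_mul]
  refine Finset.sum_congr rfl fun k _ => ?_
  rw [ENNReal.toReal_ofReal (rowStochastic_nonneg hP s k)]

lemma integrable_eval_chainLaw (hP : P ∈ Matrix.rowStochastic ℝ (Fin n)) (s : Fin n)
    (g : Fin n → ℝ) (t : ℕ) : Integrable (fun x => g (x t)) (chainLaw hP s) := by
  refine Integrable.of_bound (C := ‖g‖)
    ((measurable_of_finite g).comp (measurable_pi_apply t)).aestronglyMeasurable ?_
  exact Filter.Eventually.of_forall fun x => norm_le_pi_norm g (x t)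

/-- The Markov property: condition on the trajectory up to time t and integrate the last step. -/
lemma integral_eval_succ_chainLaw (hP : P ∈ Matrix.rowStochastic ℝ (Fin n)) (s : Fin n)
    (g : Fin n → ℝ) (t : ℕ) :
    ∫ x, g (x (t + 1)) ∂(chainLaw hP s) = ∫ x, P.mulVec g (x t) ∂(chainLaw hP s) := by
  have h1 := Kernel.integral_traj_partialTraj (κ := stepKernel hP) (X := fun _ => Fin n)
    (Nat.zero_le t) (integrable_eval_chainLaw hP s g (t + 1))
  have h2 : ∀ x : Π _ : Finset.Iic t, Fin n,
      ∫ y, g (y (t + 1)) ∂(Kernel.traj (X := fun _ => Fin n) (stepKernel hP) t x)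
        = P.mulVec g (x ⟨t, Finset.mem_Iic.2 le_rfl⟩) := by
    intro x
    rw [← integral_nextState hP]
    have h3 := Kernel.map_traj_succ_self (κ := stepKernel hP) (X := fun _ => Fin n) (a := t)
    have h4 : (nextState hP (x ⟨t, Finset.mem_Iic.2 le_rfl⟩)).toMeasure = stepKernel hP t x := rfl
    rw [h4, ← h3, Kernel.map_apply _ (measurable_pi_apply _)]
    exact (integral_map (measurable_pi_apply (t + 1)).aemeasurable
      (measurable_of_finite g).aestronglyMeasurable).symm
  simp_rw [h2] at h1
  rw [← Kernel.traj_map_frestrictLe_apply (κ := stepKernel hP) (X := fun _ => Fin n),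
    integral_map (Preorder.measurable_frestrictLe t).aemeasurable
      (measurable_of_finite _).aestronglyMeasurable] at h1
  exact h1.symm

lemma integral_eval_zero_chainLaw (hP : P ∈ Matrix.rowStochastic ℝ (Fin n)) (s : Fin n)
    (g : Fin n → ℝ) : ∫ x, g (x 0) ∂(chainLaw hP s) = g s := by
  have h := Kernel.traj_map_frestrictLe_apply (κ := stepKernel hP) (X := fun _ => Fin n) 0 0
    (fun _ => s)
  rw [Kernel.partialTraj_self, Kernel.id_apply] at h
  have hm : AEStronglyMeasurable
      (fun y : Π _ : Finset.Iic 0, Fin n => g (y ⟨0, Finset.mem_Iic.2 le_rfl⟩))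
      (Measure.dirac fun _ => s) :=
    (measurable_of_finite _).aestronglyMeasurable
  have h5 := integral_map (μ := chainLaw hP s)
    (Preorder.measurable_frestrictLe (X := fun _ => Fin n) 0).aemeasurable (by
      rw [chainLaw, h]; exact hm)
  rw [chainLaw, h] at h5
  rw [chainLaw]
  refine Eq.trans h5.symm ?_
  rw [integral_dirac]

lemma integral_eval_chainLaw (hP : P ∈ Matrix.rowStochastic ℝ (Fin n)) (s : Fin n)
    (g : Fin n → ℝ) (t : ℕ) :
    ∫ x, g (x t) ∂(chainLaw hP s) = (P ^ t).mulVec g s := by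
  induction t generalizing g with
  | zero => simp [integral_eval_zero_chainLaw]
  | succ t ih => rw [integral_eval_succ_chainLaw, ih, Matrix.mulVec_mulVec, pow_succ]

lemma hasSum_valueFunction (hP : P ∈ Matrix.rowStochastic ℝ (Fin n)) {γ : ℝ} (hγ : 0 ≤ γ)
    (hγ1 : γ < 1) (r : Fin n → ℝ) (s : Fin n) :
    HasSum (fun t => γ ^ t * (P ^ t).mulVec r s) (valueFunction hP γ r s) := by
  have h := hasSum_integral_of_summable_integral_norm (μ := chainLaw hP s)
    (F := fun t x => γ ^ t * r (x t))
    (fun t => (integrable_eval_chainLaw hP s r t).const_mul _) ?_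
  · simp only [integral_const_mul, integral_eval_chainLaw] at h
    exact h
  · refine Summable.of_nonneg_of_le (fun t => integral_nonneg fun _ => norm_nonneg _)
      (fun t => ?_) ((summable_geometric_of_lt_one hγ hγ1).mul_right ‖r‖)
    calc ∫ x, ‖γ ^ t * r (x t)‖ ∂(chainLaw hP s)
        ≤ ∫ _, γ ^ t * ‖r‖ ∂(chainLaw hP s) := by
          refine integral_mono ((integrable_eval_chainLaw hP s r t).const_mul _).norm
            (integrable_const _) fun x => ?_
          simp only [norm_mul, norm_pow, Real.norm_of_nonneg hγ]
          gcongr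
          exact norm_le_pi_norm r (x t)
      _ = _ := by simp

lemma valueFunction_bellman (hP : P ∈ Matrix.rowStochastic ℝ (Fin n)) {γ : ℝ} (hγ : 0 ≤ γ)
    (hγ1 : γ < 1) (r : Fin n → ℝ) (s : Fin n) :
    valueFunction hP γ r s = r s + γ * P.mulVec (valueFunction hP γ r) s := by
  have h1 := (hasSum_nat_add_iff' 1).2 (hasSum_valueFunction hP hγ hγ1 r s)
  have h2 : HasSum (fun t => γ ^ (t + 1) * (P ^ (t + 1)).mulVec r s)
      (γ * P.mulVec (valueFunction hP γ r) s) := by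
    have h3 : HasSum (fun t => ∑ k, P s k * (γ ^ t * (P ^ t).mulVec r k))
        (∑ k, P s k * valueFunction hP γ r k) :=
      hasSum_sum fun k _ => (hasSum_valueFunction hP hγ hγ1 r k).mul_left _
    convert! h3.mul_left γ using 1
    funext t
    rw [pow_succ' P, ← Matrix.mulVec_mulVec]
    simp only [Matrix.mulVec, dotProduct, Finset.mul_sum]
    refine Finset.sum_congr rfl fun k _ => Finset.sum_congr rfl fun l _ => ?_
    ring
  have h4 := h1.unique h2
  simp at h4
  linarith

end Bellman

/-! ### The resolvent of a stochastic matrix -/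

section Resolvent

variable {n : ℕ} {A : Matrix (Fin n) (Fin n) ℝ} {γ : ℝ}

lemma rowStochastic_mulVec_le (hA : A ∈ Matrix.rowStochastic ℝ (Fin n)) {v : Fin n → ℝ} {c : ℝ}
    (hv : ∀ k, v k ≤ c) (j : Fin n) : A.mulVec v j ≤ c := by
  calc A.mulVec v j = ∑ k, A j k * v k := rfl
    _ ≤ ∑ k, A j k * c :=
        Finset.sum_le_sum fun k _ => mul_le_mul_of_nonneg_left (hv k) (rowStochastic_nonneg hA j k)
    _ = c := by rw [← Finset.sum_mul, rowStochastic_sum hA, one_mul]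

lemma rowStochastic_mulVec_nonneg (hA : A ∈ Matrix.rowStochastic ℝ (Fin n)) {v : Fin n → ℝ}
    (hv : ∀ k, 0 ≤ v k) (j : Fin n) : 0 ≤ A.mulVec v j := by
  rw [Matrix.mulVec, dotProduct]
  exact Finset.sum_nonneg fun k _ => mul_nonneg (rowStochastic_nonneg hA j k) (hv k)

/-- Maximum principle: at a maximiser m of v, averaging gives A v ≤ v(m), hence (1-γ)·v(m) ≤ c.
Invertibility, monotonicity and the norm bound of the resolvent all follow from it. -/
lemma le_of_sub_mulVec_le (hA : A ∈ Matrix.rowStochastic ℝ (Fin n)) (hγ : 0 ≤ γ) (hγ1 : γ < 1)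
    {v : Fin n → ℝ} {c : ℝ} (hv : ∀ j, v j - γ * A.mulVec v j ≤ c) (j : Fin n) :
    v j ≤ c / (1 - γ) := by
  obtain ⟨m, -, hm⟩ := Finset.exists_max_image Finset.univ v ⟨j, Finset.mem_univ j⟩
  have h1 := rowStochastic_mulVec_le hA (fun k => hm k (Finset.mem_univ k)) m
  have h2 := hv m
  have h3 := hm j (Finset.mem_univ j)
  rw [le_div_iff₀ (by linarith)]
  nlinarith

lemma one_sub_smul_mulVec (v : Fin n → ℝ) (j : Fin n) :
    (1 - γ • A).mulVec v j = v j - γ * A.mulVec v j := by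
  simp [Matrix.sub_mulVec, Matrix.smul_mulVec]

lemma isUnit_det_one_sub_smul (hA : A ∈ Matrix.rowStochastic ℝ (Fin n)) (hγ : 0 ≤ γ)
    (hγ1 : γ < 1) : IsUnit (1 - γ • A).det := by
  rw [← Matrix.isUnit_iff_isUnit_det, ← Matrix.mulVec_injective_iff_isUnit]
  intro v w hvw
  have key : ∀ v w : Fin n → ℝ, (1 - γ • A).mulVec v = (1 - γ • A).mulVec w → v ≤ w := by
    intro v w h j
    have h1 := le_of_sub_mulVec_le hA hγ hγ1 (v := v - w) (c := 0) (fun k => by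
      rw [← one_sub_smul_mulVec, Matrix.mulVec_sub, h, sub_self]; simp) j
    simpa using h1
  exact le_antisymm (key v w hvw) (key w v hvw.symm)

lemma plugIn_sub_mulVec (hA : A ∈ Matrix.rowStochastic ℝ (Fin n)) (hγ : 0 ≤ γ) (hγ1 : γ < 1)
    (w : Fin n → ℝ) (j : Fin n) :
    plugIn γ A w j - γ * A.mulVec (plugIn γ A w) j = w j := by
  rw [← one_sub_smul_mulVec, plugIn, Matrix.mulVec_mulVec,
    Matrix.mul_nonsing_inv _ (isUnit_det_one_sub_smul hA hγ hγ1), Matrix.one_mulVec]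

lemma plugIn_of_sub_mulVec (hA : A ∈ Matrix.rowStochastic ℝ (Fin n)) (hγ : 0 ≤ γ) (hγ1 : γ < 1)
    (v : Fin n → ℝ) : plugIn γ A (fun j => v j - γ * A.mulVec v j) = v := by
  simp_rw [← one_sub_smul_mulVec]
  change ((1 - γ • A)⁻¹).mulVec ((1 - γ • A).mulVec v) = v
  rw [Matrix.mulVec_mulVec, Matrix.nonsing_inv_mul _ (isUnit_det_one_sub_smul hA hγ hγ1),
    Matrix.one_mulVec]

lemma plugIn_add (v w : Fin n → ℝ) : plugIn γ A (v + w) = plugIn γ A v + plugIn γ A w :=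
  Matrix.mulVec_add _ _ _

lemma plugIn_sub (v w : Fin n → ℝ) : plugIn γ A (v - w) = plugIn γ A v - plugIn γ A w :=
  Matrix.mulVec_sub _ _ _

lemma plugIn_smul (c : ℝ) (w : Fin n → ℝ) : plugIn γ A (c • w) = c • plugIn γ A w :=
  Matrix.mulVec_smul _ _ _

lemma plugIn_le (hA : A ∈ Matrix.rowStochastic ℝ (Fin n)) (hγ : 0 ≤ γ) (hγ1 : γ < 1)
    {w : Fin n → ℝ} {c : ℝ} (hw : ∀ j, w j ≤ c) (j : Fin n) : plugIn γ A w j ≤ c / (1 - γ) :=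
  le_of_sub_mulVec_le hA hγ hγ1 (fun k => by rw [plugIn_sub_mulVec hA hγ hγ1]; exact hw k) j

lemma plugIn_mono (hA : A ∈ Matrix.rowStochastic ℝ (Fin n)) (hγ : 0 ≤ γ) (hγ1 : γ < 1)
    {v w : Fin n → ℝ} (h : ∀ j, v j ≤ w j) (j : Fin n) : plugIn γ A v j ≤ plugIn γ A w j := by
  have h1 := plugIn_le hA hγ hγ1 (w := v - w) (c := 0) (fun k => by simpa using h k) j
  rw [plugIn_sub] at h1
  simpa using h1

lemma plugIn_const (hA : A ∈ Matrix.rowStochastic ℝ (Fin n)) (hγ : 0 ≤ γ) (hγ1 : γ < 1)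
    (c : ℝ) : plugIn γ A (fun _ => c) = fun _ => c / (1 - γ) := by
  have h := plugIn_of_sub_mulVec hA hγ hγ1 (fun _ => c / (1 - γ))
  have h1 : 1 - γ ≠ 0 := by linarith
  convert! h using 2
  funext j
  have : A.mulVec (fun _ => c / (1 - γ)) j = c / (1 - γ) := by
    simp only [Matrix.mulVec, dotProduct]
    rw [← Finset.sum_mul, rowStochastic_sum hA, one_mul]
  rw [this]; field_simp

lemma norm_plugIn_le (hA : A ∈ Matrix.rowStochastic ℝ (Fin n)) (hγ : 0 ≤ γ) (hγ1 : γ < 1)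
    (w : Fin n → ℝ) : ‖plugIn γ A w‖ ≤ ‖w‖ / (1 - γ) := by
  have h1 : 0 < 1 - γ := by linarith
  refine (pi_norm_le_iff_of_nonneg (by positivity)).2 fun j => abs_le.2 ⟨?_, ?_⟩
  · have h2 := plugIn_le hA hγ hγ1 (w := (-1 : ℝ) • w) (c := ‖w‖) (fun k => by
      have := (abs_le.1 (norm_le_pi_norm w k)).1
      simp only [Pi.smul_apply, smul_eq_mul]; linarith) j
    rw [plugIn_smul] at h2
    simp only [Pi.smul_apply, smul_eq_mul] at h2; linarith
  · exact plugIn_le hA hγ hγ1 (fun k => (abs_le.1 (norm_le_pi_norm w k)).2) j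

/-- Jensen, via Cauchy–Schwarz: each row of the resolvent is nonnegative with sum 1/(1-γ). This is
where half a power of the horizon is saved. -/
lemma sq_plugIn_sqrt_le (hA : A ∈ Matrix.rowStochastic ℝ (Fin n)) (hγ : 0 ≤ γ) (hγ1 : γ < 1)
    {g : Fin n → ℝ} (hg : ∀ j, 0 ≤ g j) (j : Fin n) :
    (1 - γ) * plugIn γ A (fun k => √(g k)) j ^ 2 ≤ plugIn γ A g j := by
  have h1 : 0 < 1 - γ := by linarith
  have hQ : ∀ k, 0 ≤ (1 - γ • A)⁻¹ j k := by
    intro k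
    have h := plugIn_mono hA hγ hγ1 (v := 0) (w := Pi.single k 1) (fun l => by
      rw [Pi.single_apply]; split_ifs <;> simp) j
    simpa [plugIn] using h
  have hsum : ∑ k, (1 - γ • A)⁻¹ j k = 1 / (1 - γ) := by
    have h := congrFun (plugIn_const hA hγ hγ1 1) j
    simpa [plugIn, Matrix.mulVec, dotProduct] using h
  have hcs := Finset.sum_sq_le_sum_mul_sum_of_sq_le_mul Finset.univ
    (r := fun k => (1 - γ • A)⁻¹ j k * √(g k)) (f := fun k => (1 - γ • A)⁻¹ j k)
    (g := fun k => (1 - γ • A)⁻¹ j k * g k) (fun k _ => hQ k)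
    (fun k _ => mul_nonneg (hQ k) (hg k))
    (fun k _ => by rw [mul_pow, Real.sq_sqrt (hg k)]; exact le_of_eq (by ring))
  rw [hsum] at hcs
  calc (1 - γ) * plugIn γ A (fun k => √(g k)) j ^ 2
      ≤ (1 - γ) * (1 / (1 - γ) * plugIn γ A g j) := by gcongr; exact hcs
    _ = plugIn γ A g j := by field_simp

/-- The plug-in estimate of a value function, for a stochastic matrix `A` whose action on the value
function and on its square obeys Bernstein-type bounds. -/
lemma abs_plugIn_sub_le (hA : A ∈ Matrix.rowStochastic ℝ (Fin n))
    {P : Matrix (Fin n) (Fin n) ℝ}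
    (hγ : 0 ≤ γ) (hγ1 : γ < 1) {r J v : Fin n → ℝ} {ρ M τ : ℝ} (hρ : 0 ≤ ρ) (hr : ∀ j, |r j| ≤ ρ)
    (hM : M = ρ / (1 - γ)) (hJM : ∀ j, |J j| ≤ M) (hJ : ∀ j, J j = r j + γ * P.mulVec J j)
    (hv : ∀ j, v j = P.mulVec (J ^ 2) j - P.mulVec J j ^ 2) (hv0 : ∀ j, 0 ≤ v j) (hτ : 0 ≤ τ)
    (h1 : ∀ j, |A.mulVec J j - P.mulVec J j| ≤ 2 * (√(v j) * √τ) + 8 * M * τ)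
    (h2 : ∀ j, |A.mulVec (J ^ 2) j - P.mulVec (J ^ 2) j|
      ≤ 4 * M * (√(v j) * √τ) + 8 * M ^ 2 * τ) (j : Fin n) :
    |plugIn γ A r j - J j| ≤ 20 * M * (√(τ / (1 - γ)) + τ / (1 - γ)) := by
  have hg : 0 < 1 - γ := by linarith
  have hM0 : 0 ≤ M := by rw [hM]; positivity
  set b := √(τ / (1 - γ)) with hb
  have hb0 : 0 ≤ b := Real.sqrt_nonneg _
  have hb2 : b ^ 2 = τ / (1 - γ) := Real.sq_sqrt (by positivity)
  set s : Fin n → ℝ := fun k => √(γ ^ 2 * v k) with hs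
  have hs' : ∀ k, s k = γ * √(v k) := fun k => by
    rw [hs]; simp only; rw [Real.sqrt_mul (sq_nonneg γ), Real.sqrt_sq hγ]
  set y := plugIn γ A s j with hy
  have hτb : √τ = b * √(1 - γ) := by
    rw [hb, ← Real.sqrt_mul (by positivity)]; congr 1; field_simp
  set z := √(1 - γ) * y with hz
  have hγsq : γ ^ 2 ≤ γ := by nlinarith
  -- the weighted variance
  have hvar : ∀ k, (γ ^ 2 • v) k ≤ ((fun k => (-(J ^ 2)) k - γ * A.mulVec (-(J ^ 2)) k)
      + ((fun _ => 2 * ρ * M + 8 * M ^ 2 * τ) + (4 * M * √τ) • s) : Fin n → ℝ) k := by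
    intro k
    have e1 := hJ k
    have e2 := abs_le.1 (h2 k)
    have e3 : 0 ≤ A.mulVec (J ^ 2) k := rowStochastic_mulVec_nonneg hA (fun l => sq_nonneg _) k
    have e4 : r k * J k ≤ ρ * M := by
      refine (le_abs_self _).trans ?_
      rw [abs_mul]
      exact mul_le_mul (hr k) (hJM k) (abs_nonneg _) hρ
    have e5 : γ ^ 2 * (P.mulVec (J ^ 2) k - A.mulVec (J ^ 2) k)
        ≤ 4 * M * √τ * s k + 8 * M ^ 2 * τ := by
      rw [hs']
      have e6 : 0 ≤ √(v k) * √τ := by positivity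
      have e7 : 0 ≤ 8 * M ^ 2 * τ := by positivity
      calc γ ^ 2 * (P.mulVec (J ^ 2) k - A.mulVec (J ^ 2) k)
          ≤ γ ^ 2 * (4 * M * (√(v k) * √τ) + 8 * M ^ 2 * τ) := by gcongr; linarith
        _ = γ ^ 2 * (4 * M * (√(v k) * √τ)) + γ ^ 2 * (8 * M ^ 2 * τ) := by ring
        _ ≤ γ * (4 * M * (√(v k) * √τ)) + 1 * (8 * M ^ 2 * τ) := by
            gcongr; linarith
        _ = _ := by ring
    -- By Bellman, -γ²(PJ)² ≤ -J² + 2rJ. After P is exchanged for A and γ² for γ in front of A(J²),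
    -- the main term is -(J² - γA(J²)), which the resolvent maps to -J² ≤ 0.
    have e8 : γ ^ 2 * P.mulVec J k ^ 2 = (J k - r k) ^ 2 := by rw [e1]; ring
    simp only [Pi.add_apply, Pi.smul_apply, Pi.neg_apply, Pi.pow_apply, smul_eq_mul,
      Matrix.mulVec_neg]
    rw [hv k]
    nlinarith [sq_nonneg (r k), mul_le_mul_of_nonneg_right hγsq e3]
  have hvar2 : plugIn γ A (γ ^ 2 • v) j
      ≤ 2 * M ^ 2 + 8 * M ^ 2 * b ^ 2 + 4 * M * √τ * y := by
    refine (plugIn_mono hA hγ hγ1 hvar j).trans ?_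
    rw [plugIn_add, plugIn_add, plugIn_smul, plugIn_const hA hγ hγ1,
      plugIn_of_sub_mulVec hA hγ hγ1]
    simp only [Pi.add_apply, Pi.smul_apply, Pi.neg_apply, Pi.pow_apply, smul_eq_mul]
    have e1 : (2 * ρ * M + 8 * M ^ 2 * τ) / (1 - γ) = 2 * M ^ 2 + 8 * M ^ 2 * b ^ 2 := by
      rw [hb2, hM]; field_simp
    rw [e1]
    nlinarith [sq_nonneg (J j)]
  -- The price of exchanging P for A is linear in y itself. With Jensen this becomes a quadratic
  -- inequality for z, which is then solved by completing the square.
  have hz2 : z ^ 2 ≤ 2 * M ^ 2 + 8 * M ^ 2 * b ^ 2 + 4 * M * b * z := by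
    have e1 := sq_plugIn_sqrt_le hA hγ hγ1 (g := γ ^ 2 • v)
      (fun k => mul_nonneg (sq_nonneg γ) (hv0 k)) j
    have e2 : z ^ 2 = (1 - γ) * y ^ 2 := by rw [hz, mul_pow, Real.sq_sqrt hg.le]
    have e3 : 4 * M * b * z = 4 * M * √τ * y := by rw [hz, hτb]; ring
    rw [e2, e3]
    exact e1.trans hvar2
  have hMb : 0 ≤ M * b := by positivity
  have hz3 : z ≤ 2 * M + 6 * M * b := by
    have e1 : (z - 2 * M * b) ^ 2 ≤ (2 * M + 4 * M * b) ^ 2 := by nlinarith [mul_nonneg hM0 hMb]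
    have := (abs_le.1 (abs_le_of_sq_le_sq e1 (by positivity))).2
    linarith
  have hy2 : 2 * √τ * y + 8 * M * b ^ 2 ≤ 20 * M * (b + τ / (1 - γ)) := by
    rw [← hb2, hτb]
    have e1 : 2 * (b * √(1 - γ)) * y = 2 * b * z := by rw [hz]; ring
    rw [e1]
    nlinarith [mul_le_mul_of_nonneg_left hz3 hb0]
  -- the error
  have herr : ∀ k, |r k - (J k - γ * A.mulVec J k)| ≤ ((2 * √τ) • s + fun _ => 8 * M * τ : Fin n → ℝ) k := by
    intro k
    have e1 : r k - (J k - γ * A.mulVec J k) = γ * (A.mulVec J k - P.mulVec J k) := by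
      rw [hJ k]; ring
    rw [e1, abs_mul, abs_of_nonneg hγ]
    simp only [Pi.add_apply, Pi.smul_apply, smul_eq_mul, hs']
    have e2 : 0 ≤ 8 * M * τ := by positivity
    calc γ * |A.mulVec J k - P.mulVec J k| ≤ γ * (2 * (√(v k) * √τ) + 8 * M * τ) := by
          gcongr; exact h1 k
      _ = γ * (2 * (√(v k) * √τ)) + γ * (8 * M * τ) := by ring
      _ ≤ γ * (2 * (√(v k) * √τ)) + 1 * (8 * M * τ) := by gcongr
      _ = _ := by ring
  have hbound : plugIn γ A ((2 * √τ) • s + fun _ => 8 * M * τ) j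
      = 2 * √τ * y + 8 * M * b ^ 2 := by
    rw [plugIn_add, plugIn_smul, plugIn_const hA hγ hγ1]
    simp only [Pi.add_apply, Pi.smul_apply, smul_eq_mul]
    rw [hb2]; ring
  -- The scalar c is taken as -1 and 1 below, so that monotonicity yields both sides of the absolute
  -- value.
  have hΔ : ∀ (c : ℝ), plugIn γ A (c • fun k => r k - (J k - γ * A.mulVec J k)) j
      = c * (plugIn γ A r j - J j) := by
    intro c
    have e1 : (fun k => r k - (J k - γ * A.mulVec J k))
        = r - fun k => J k - γ * A.mulVec J k := rfl
    rw [plugIn_smul, e1, plugIn_sub, plugIn_of_sub_mulVec hA hγ hγ1]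
    rfl
  refine le_trans (abs_le.2 ⟨?_, ?_⟩) (hbound.le.trans hy2)
  · have e1 := plugIn_mono hA hγ hγ1 (v := (-1 : ℝ) • fun k => r k - (J k - γ * A.mulVec J k))
      (w := (2 * √τ) • s + fun _ => 8 * M * τ) (fun k => by
        have := (abs_le.1 (herr k)).1
        simp only [Pi.smul_apply, smul_eq_mul] at this ⊢; linarith) j
    rw [hΔ] at e1
    linarith
  · have e1 := plugIn_mono hA hγ hγ1 (v := (1 : ℝ) • fun k => r k - (J k - γ * A.mulVec J k))
      (w := (2 * √τ) • s + fun _ => 8 * M * τ) (fun k => by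
        have := (abs_le.1 (herr k)).2
        simp only [Pi.smul_apply, smul_eq_mul] at this ⊢; linarith) j
    rw [hΔ] at e1
    linarith

end Resolvent

/-! ### Bernstein's inequality -/

section Bernstein

variable {Ω : Type*} [MeasurableSpace Ω] {μ : Measure Ω} [IsProbabilityMeasure μ]

lemma integrable_of_abs_le {Y : Ω → ℝ} {K : ℝ} (hm : Measurable Y) (hK : ∀ ω, |Y ω| ≤ K) :
    Integrable Y μ :=
  Integrable.of_bound hm.aestronglyMeasurable K (Filter.Eventually.of_forall hK)

/-- Integrate exp(x) ≤ 1 + x + x², valid for |x| ≤ 1; the linear term has mean zero. -/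
lemma mgf_le_exp_sq_mul {Y : Ω → ℝ} {K v l : ℝ} (hm : Measurable Y) (hK : ∀ ω, |Y ω| ≤ K)
    (hmean : ∫ ω, Y ω ∂μ = 0) (hvar : ∫ ω, Y ω ^ 2 ∂μ ≤ v) (hl : |l| * K ≤ 1) :
    mgf Y μ l ≤ Real.exp (l ^ 2 * v) := by
  have hb : ∀ ω, |l * Y ω| ≤ 1 := fun ω => by
    rw [abs_mul]
    exact (mul_le_mul_of_nonneg_left (hK ω) (abs_nonneg l)).trans hl
  have hsq : Integrable (fun ω => Y ω ^ 2) μ :=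
    integrable_of_abs_le (K := K ^ 2) (hm.pow_const 2) fun ω => by
      rw [abs_pow]; exact pow_le_pow_left₀ (abs_nonneg _) (hK ω) 2
  have hY := integrable_of_abs_le (μ := μ) hm hK
  have hexp : Integrable (fun ω => Real.exp (l * Y ω)) μ :=
    integrable_of_abs_le (K := Real.exp 1) (hm.const_mul l).exp fun ω => by
      rw [Real.abs_exp]; exact Real.exp_le_exp.2 ((le_abs_self _).trans (hb ω))
  calc mgf Y μ l ≤ ∫ ω, (1 + l * Y ω + l ^ 2 * Y ω ^ 2) ∂μ := by
        refine integral_mono hexp (((integrable_const _).add (hY.const_mul l)).add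
          (hsq.const_mul _)) fun ω => ?_
        have h1 := (abs_le.1 (Real.abs_exp_sub_one_sub_id_le (hb ω))).2
        simp only
        rw [mul_pow] at h1; linarith
    _ = 1 + l ^ 2 * ∫ ω, Y ω ^ 2 ∂μ := by
        have e1 : ∫ ω, (1 + l * Y ω) ∂μ = 1 := by
          rw [integral_add (integrable_const _) (hY.const_mul l), integral_const_mul, hmean]
          simp
        have e2 : Integrable (fun ω => 1 + l * Y ω) μ := (integrable_const _).add (hY.const_mul l)
        rw [integral_add e2 (hsq.const_mul _), integral_const_mul, e1]
    _ ≤ 1 + l ^ 2 * v := by gcongr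
    _ ≤ _ := by rw [add_comm]; exact Real.add_one_le_exp _

lemma measure_sum_ge_le {Y : ℕ → Ω → ℝ} {K v s l : ℝ} {T : ℕ} (hm : ∀ t, Measurable (Y t))
    (hind : iIndepFun Y μ) (hK : ∀ t ω, |Y t ω| ≤ K) (hmean : ∀ t, ∫ ω, Y t ω ∂μ = 0)
    (hvar : ∀ t, ∫ ω, Y t ω ^ 2 ∂μ ≤ v) (hv : 0 ≤ v) (hK0 : 0 < K) (hs : 0 < s)
    (hl : 4 * l * (T * v + K * s) ≤ s ^ 2) :
    μ.real {ω | s ≤ ∑ t ∈ Finset.range T, Y t ω} ≤ Real.exp (-l) := by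
  set D := T * v + K * s with hD
  have hD0 : 0 < D := by positivity
  -- The Chernoff parameter: a·K ≤ 1/2 keeps the moment bound valid, and the exponent is at most
  -- -a·s/2 = -s²/(4D).
  set a := s / (2 * D) with ha
  have ha0 : 0 ≤ a := by positivity
  have haD : a * D = s / 2 := by rw [ha]; field_simp
  have haK : |a| * K ≤ 1 := by
    rw [abs_of_nonneg ha0, ha, div_mul_eq_mul_div, div_le_one (by positivity)]
    have : 0 ≤ T * v := by positivity
    nlinarith
  have hint : Integrable (fun ω => Real.exp (a * (∑ t ∈ Finset.range T, Y t) ω)) μ := by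
    refine integrable_of_abs_le (K := Real.exp (a * (T * K))) ?_ fun ω => ?_
    · simp only [Finset.sum_apply]
      exact ((Finset.measurable_sum _ fun t _ => hm t).const_mul a).exp
    · rw [Real.abs_exp, Finset.sum_apply]
      gcongr
      calc ∑ t ∈ Finset.range T, Y t ω ≤ ∑ t ∈ Finset.range T, K :=
            Finset.sum_le_sum fun t _ => (le_abs_self _).trans (hK t ω)
        _ = T * K := by simp
  have h1 := measure_ge_le_exp_mul_mgf (μ := μ) (X := ∑ t ∈ Finset.range T, Y t) s ha0 hint
  rw [hind.mgf_sum hm] at h1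
  simp only [Finset.sum_apply] at h1
  refine h1.trans ?_
  calc Real.exp (-a * s) * ∏ t ∈ Finset.range T, mgf (Y t) μ a
      ≤ Real.exp (-a * s) * ∏ _t ∈ Finset.range T, Real.exp (a ^ 2 * v) := by
        gcongr with t
        · exact fun t _ => mgf_nonneg
        · exact mgf_le_exp_sq_mul (hm t) (hK t) (hmean t) (hvar t) haK
    _ = Real.exp (-a * s + T * (a ^ 2 * v)) := by
        rw [Finset.prod_const, Finset.card_range, ← Real.exp_nat_mul, Real.exp_add]
    _ ≤ Real.exp (-l) := by
        gcongr
        have h2 : T * (a ^ 2 * v) ≤ a * (s / 2) := by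
          rw [← haD]
          have : 0 ≤ a * a * (K * s) := by positivity
          rw [hD]; nlinarith
        have h3 : l ≤ a * (s / 2) := by
          rw [ha, div_mul_div_comm, le_div_iff₀ (by positivity)]
          nlinarith
        linarith

/-- The exponent in Bernstein's inequality at the value `s`. -/
noncomputable def bernsteinExponent (V K s : ℝ) : ℝ := s ^ 2 / (4 * (V + K * |s|))

lemma bernsteinExponent_nonneg {V K : ℝ} (hV : 0 ≤ V) (hK : 0 ≤ K) (s : ℝ) :
    0 ≤ bernsteinExponent V K s := by
  unfold bernsteinExponent; positivity

lemma measurable_bernsteinExponent (V K : ℝ) : Measurable (bernsteinExponent V K) := by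
  have : Measurable fun s : ℝ => |s| := measurable_id.abs
  unfold bernsteinExponent; fun_prop

lemma abs_le_of_bernsteinExponent_le {V K s l : ℝ} (hV : 0 ≤ V) (hK : 0 < K)
    (h : bernsteinExponent V K s ≤ l) : |s| ≤ 2 * √(V * l) + 4 * K * l := by
  have hl : 0 ≤ l := (bernsteinExponent_nonneg hV hK.le s).trans h
  rcases (abs_nonneg s).eq_or_lt with h0 | h0
  · rw [← h0]; positivity
  have h1 : |s| ^ 2 ≤ 4 * V * l + 4 * K * l * |s| := by
    rw [bernsteinExponent, div_le_iff₀ (by positivity)] at h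
    rw [sq_abs]; linarith
  by_contra! hc
  have h2 : √(V * l) ^ 2 = V * l := Real.sq_sqrt (by positivity)
  have h3 := Real.sqrt_nonneg (V * l)
  have h4 : 0 ≤ 4 * K * l := by positivity
  nlinarith

/-- Writing Bernstein as an exponential tail of one random exponent normalises sums of different
variances to a common scale, so their maximum can be taken before inverting. -/
lemma measure_le_bernsteinExponent_le {Y : ℕ → Ω → ℝ} {K v l : ℝ} {T : ℕ}
    (hm : ∀ t, Measurable (Y t))
    (hind : iIndepFun Y μ) (hK : ∀ t ω, |Y t ω| ≤ K) (hmean : ∀ t, ∫ ω, Y t ω ∂μ = 0)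
    (hvar : ∀ t, ∫ ω, Y t ω ^ 2 ∂μ ≤ v) (hv : 0 ≤ v) (hK0 : 0 < K) (hl : 0 < l) :
    μ.real {ω | l ≤ bernsteinExponent (T * v) K (∑ t ∈ Finset.range T, Y t ω)}
      ≤ 2 * Real.exp (-l) := by
  set V := T * v with hVdef
  have hV : 0 ≤ V := by positivity
  -- The positive root of s² = 4l(V + K·s).
  set s := 2 * K * l + √(4 * K ^ 2 * l ^ 2 + 4 * V * l) with hs
  have hsq : √(4 * K ^ 2 * l ^ 2 + 4 * V * l) ^ 2 = 4 * K ^ 2 * l ^ 2 + 4 * V * l :=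
    Real.sq_sqrt (by positivity)
  have hsn := Real.sqrt_nonneg (4 * K ^ 2 * l ^ 2 + 4 * V * l)
  have hs0 : 0 < s := by positivity
  have hs2 : 4 * l * (V + K * s) ≤ s ^ 2 := by rw [hs]; nlinarith
  have h1 := measure_sum_ge_le (T := T) hm hind hK hmean hvar hv hK0 hs0 hs2
  have h2 := measure_sum_ge_le (T := T) (Y := fun t ω => -Y t ω) (μ := μ) (fun t => (hm t).neg)
    (hind.comp (fun _ x => -x) fun _ => measurable_neg) (fun t ω => by rw [abs_neg]; exact hK t ω)
    (fun t => by rw [integral_neg, hmean, neg_zero]) (fun t => by simpa using hvar t) hv hK0 hs0 hs2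
  have hsub : {ω | l ≤ bernsteinExponent V K (∑ t ∈ Finset.range T, Y t ω)}
      ⊆ {ω | s ≤ ∑ t ∈ Finset.range T, Y t ω} ∪ {ω | s ≤ ∑ t ∈ Finset.range T, -Y t ω} := by
    intro ω hω
    simp only [Set.mem_ofPred_eq, Set.mem_union, Finset.sum_neg_distrib] at hω ⊢
    set S := ∑ t ∈ Finset.range T, Y t ω
    suffices hsS : s ≤ |S| by
      rcases le_abs.1 hsS with h | h
      · exact Or.inl h
      · exact Or.inr h
    have hS0 : 0 < |S| := by
      rw [abs_pos]; intro h0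
      rw [h0, bernsteinExponent] at hω; simp at hω; linarith
    rw [bernsteinExponent, le_div_iff₀ (by positivity), ← sq_abs] at hω
    have h4 : √(4 * K ^ 2 * l ^ 2 + 4 * V * l) ≤ |S| - 2 * K * l := by
      rw [Real.sqrt_le_left]
      · nlinarith
      · by_contra! hc
        have : 0 ≤ l * V := by positivity
        nlinarith
    linarith
  calc _ ≤ _ := measureReal_mono hsub
    _ ≤ _ := measureReal_union_le _ _
    _ ≤ _ := by linarith

/-- Up to log K the tail bound says nothing; beyond it the tail is at most exp(-t), and the
layer-cake formula adds 1. -/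
lemma integral_le_log_of_tail {Z : Ω → ℝ} {K : ℝ} (hm : Measurable Z) (h0 : ∀ ω, 0 ≤ Z ω)
    (hK : 1 ≤ K) (htail : ∀ t, 0 < t → μ.real {ω | t ≤ Z ω} ≤ K * Real.exp (-t)) :
    Integrable Z μ ∧ ∫ ω, Z ω ∂μ ≤ Real.log K + 1 := by
  set a := Real.log K with ha
  have ha0 : 0 ≤ a := Real.log_nonneg hK
  have hKa : K = Real.exp a := (Real.exp_log (by linarith)).symm
  set W : Ω → ℝ := fun ω => max (Z ω - a) 0 with hW
  have hWm : Measurable W := (hm.sub_const a).max measurable_const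
  have hW0 : ∀ ω, 0 ≤ W ω := fun ω => le_max_right _ _
  have hlay : ∫⁻ ω, ENNReal.ofReal (W ω) ∂μ ≤ 1 := by
    rw [lintegral_eq_lintegral_meas_le μ (Filter.Eventually.of_forall hW0) hWm.aemeasurable]
    calc ∫⁻ t in Set.Ioi (0 : ℝ), μ {ω | t ≤ W ω}
        ≤ ∫⁻ t in Set.Ioi (0 : ℝ), ENNReal.ofReal (Real.exp (-t)) := by
          refine setLIntegral_mono (by fun_prop) fun t ht => ?_
          have ht : 0 < t := ht
          have hsub : {ω | t ≤ W ω} ⊆ {ω | a + t ≤ Z ω} := by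
            intro ω hω
            rcases le_max_iff.1 (show t ≤ max (Z ω - a) 0 from hω) with h | h
            · change a + t ≤ Z ω; linarith
            · linarith
          refine (measure_mono hsub).trans ?_
          rw [← ofReal_measureReal]
          gcongr
          refine (htail (a + t) (by linarith)).trans (le_of_eq ?_)
          rw [hKa, ← Real.exp_add]; congr 1; ring
      _ = 1 := by
          rw [← ofReal_integral_eq_lintegral_ofReal (integrableOn_exp_neg_Ioi 0)
            (Filter.Eventually.of_forall fun t => (Real.exp_pos _).le), integral_exp_neg_Ioi_zero]
          simp
  have hWint : Integrable W μ := by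
    refine ⟨hWm.aestronglyMeasurable, ?_⟩
    rw [hasFiniteIntegral_iff_ofReal (Filter.Eventually.of_forall hW0)]
    exact hlay.trans_lt ENNReal.one_lt_top
  have hWle : ∫ ω, W ω ∂μ ≤ 1 := by
    rw [integral_eq_lintegral_of_nonneg_ae (Filter.Eventually.of_forall hW0)
      hWm.aestronglyMeasurable]
    exact ENNReal.toReal_le_of_le_ofReal zero_le_one (by simpa using hlay)
  have hZW : ∀ ω, Z ω ≤ a + W ω := fun ω => by
    have := le_max_left (Z ω - a) 0
    simp only [hW]; linarith
  have hZint : Integrable Z μ := by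
    refine ((integrable_const a).add hWint).mono' hm.aestronglyMeasurable
      (Filter.Eventually.of_forall fun ω => ?_)
    rw [Real.norm_of_nonneg (h0 ω)]; exact hZW ω
  refine ⟨hZint, (integral_mono hZint ((integrable_const a).add hWint) hZW).trans ?_⟩
  rw [integral_add' (integrable_const a) hWint]
  simpa using hWle

lemma integral_iSup_le_log_of_tail {ι : Type*} [Fintype ι] [Nonempty ι] {Z : ι → Ω → ℝ} {K : ℝ}
    (hm : ∀ p, Measurable (Z p)) (h0 : ∀ p ω, 0 ≤ Z p ω) (hK : 1 ≤ K)
    (htail : ∀ p t, 0 < t → μ.real {ω | t ≤ Z p ω} ≤ K * Real.exp (-t)) :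
    Integrable (fun ω => ⨆ p, Z p ω) μ ∧
      ∫ ω, ⨆ p, Z p ω ∂μ ≤ Real.log (Fintype.card ι * K) + 1 := by
  have hcard : (1 : ℝ) ≤ Fintype.card ι := by exact_mod_cast Fintype.card_pos
  refine integral_le_log_of_tail (Measurable.iSup hm) (fun ω => Real.iSup_nonneg fun p => h0 p ω)
    (one_le_mul_of_one_le_of_one_le hcard hK) fun t ht => ?_
  have hsub : {ω | t ≤ ⨆ p, Z p ω} ⊆ ⋃ p ∈ Finset.univ, {ω | t ≤ Z p ω} := by
    intro ω hω
    obtain ⟨p, hp⟩ := exists_eq_ciSup_of_finite (f := fun p => Z p ω)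
    refine Set.mem_biUnion (Finset.mem_coe.2 (Finset.mem_univ p)) ?_
    change t ≤ Z p ω
    rw [hp]; exact hω
  calc μ.real {ω | t ≤ ⨆ p, Z p ω} ≤ _ :=
        measureReal_mono hsub (measure_ne_top _ _)
    _ ≤ ∑ p, μ.real {ω | t ≤ Z p ω} := measureReal_biUnion_finset_le _ _
    _ ≤ ∑ _p : ι, K * Real.exp (-t) := Finset.sum_le_sum fun p _ => htail p t ht
    _ = _ := by simp [mul_assoc]

end Bernstein

/-! ### The empirical transition matrix -/

section Empirical

variable {n : ℕ} {Ω : Type*} [MeasurableSpace Ω] {μ : Measure Ω}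

lemma empiricalP_mulVec (X : ℕ → Fin n → Fin n) (T : ℕ) (f : Fin n → ℝ) (j : Fin n) :
    (empiricalP X T).mulVec f j = (T : ℝ)⁻¹ * ∑ t ∈ Finset.range T, f (X t j) := by
  simp only [Matrix.mulVec, dotProduct, empiricalP, Matrix.of_apply, mul_assoc]
  rw [← Finset.mul_sum]
  congr 1
  simp only [Finset.sum_mul]
  rw [Finset.sum_comm]
  simp

lemma empiricalP_mem_rowStochastic (X : ℕ → Fin n → Fin n) {T : ℕ} (hT : 1 ≤ T) :
    empiricalP X T ∈ Matrix.rowStochastic ℝ (Fin n) := by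
  have hT0 : (T : ℝ) ≠ 0 := by positivity
  refine Matrix.mem_rowStochastic.2 ⟨fun i j => ?_, ?_⟩
  · simp only [empiricalP, Matrix.of_apply]
    exact mul_nonneg (by positivity) (Finset.sum_nonneg fun t _ => by split_ifs <;> simp)
  · funext j
    rw [empiricalP_mulVec]
    simp [hT0]

lemma integral_comp_next {P : Matrix (Fin n) (Fin n) ℝ} (hP : P ∈ Matrix.rowStochastic ℝ (Fin n))
    [IsProbabilityMeasure μ] {Y : Ω → Fin n} {j : Fin n} (hY : Measurable Y)
    (hlaw : ∀ k, μ (Y ⁻¹' {k}) = ENNReal.ofReal (P j k)) (g : Fin n → ℝ) :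
    ∫ ω, g (Y ω) ∂μ = P.mulVec g j := by
  rw [← integral_map (f := g) hY.aemeasurable (measurable_of_finite g).aestronglyMeasurable]
  have := Measure.isProbabilityMeasure_map (μ := μ) hY.aemeasurable
  rw [integral_fintype (Integrable.of_finite)]
  simp only [Matrix.mulVec, dotProduct, smul_eq_mul]
  refine Finset.sum_congr rfl fun k _ => ?_
  rw [measureReal_def, Measure.map_apply hY (measurableSet_singleton k), hlaw,
    ENNReal.toReal_ofReal (rowStochastic_nonneg hP j k)]

lemma measurable_det {B : Ω → Matrix (Fin n) (Fin n) ℝ}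
    (hB : ∀ i j, Measurable fun ω => B ω i j) : Measurable fun ω => (B ω).det := by
  simp only [Matrix.det_apply]
  refine Finset.measurable_sum _ fun σ _ => ?_
  exact (Finset.measurable_prod _ fun i _ => hB _ _).const_smul _

/-- By the adjugate formula the inverse is a polynomial in the entries divided by the determinant.
-/
lemma measurable_plugIn {A : Ω → Matrix (Fin n) (Fin n) ℝ} {w : Ω → Fin n → ℝ} (γ : ℝ)
    (hA : ∀ i j, Measurable fun ω => A ω i j) (hw : Measurable w) :
    Measurable fun ω => plugIn γ (A ω) (w ω) := by
  have hB : ∀ i j, Measurable fun ω => (1 - γ • A ω) i j := fun i j => by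
    simp only [Matrix.sub_apply, Matrix.smul_apply]
    exact ((hA i j).const_smul γ).const_sub _
  refine measurable_pi_lambda _ fun j => ?_
  simp only [plugIn, Matrix.mulVec, dotProduct, Matrix.inv_def, Ring.inverse_eq_inv',
    Matrix.smul_apply, smul_eq_mul]
  refine Finset.measurable_sum _ fun k _ => ?_
  refine ((measurable_det hB).inv.mul ?_).mul ((measurable_pi_apply k).comp hw)
  simp only [Matrix.adjugate_apply]
  refine measurable_det fun a b => ?_
  simp only [Matrix.updateRow_apply]
  split_ifs
  · exact measurable_const
  · exact hB a b

lemma measurable_empiricalP {X : ℕ → Fin n → Ω → Fin n} (hX : ∀ t j, Measurable (X t j)) (T : ℕ)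
    (i j : Fin n) : Measurable fun ω => empiricalP (fun t j => X t j ω) T i j := by
  simp only [empiricalP, Matrix.of_apply]
  refine (Finset.measurable_sum _ fun t _ => ?_).const_mul _
  exact Measurable.ite ((hX t i) (measurableSet_singleton j)) measurable_const measurable_const

lemma integral_sqrt_le [IsProbabilityMeasure μ] {f : Ω → ℝ} (hf : Integrable f μ)
    (h0 : ∀ ω, 0 ≤ f ω) :
    Integrable (fun ω => √(f ω)) μ ∧ ∫ ω, √(f ω) ∂μ ≤ √(∫ ω, f ω ∂μ) := by
  have h1 : Integrable (fun ω => √(f ω)) μ := by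
    refine ((integrable_const 1).add hf).mono'
      (Real.continuous_sqrt.comp_aestronglyMeasurable hf.1) (Filter.Eventually.of_forall fun ω => ?_)
    rw [Real.norm_of_nonneg (Real.sqrt_nonneg _)]
    have := Real.sq_sqrt (h0 ω)
    simp only [Pi.add_apply]
    nlinarith [sq_nonneg (√(f ω) - 1), Real.sqrt_nonneg (f ω)]
  refine ⟨h1, ?_⟩
  exact Real.strictConcaveOn_sqrt.concaveOn.le_map_integral Real.continuous_sqrt.continuousOn
    isClosed_Ici (Filter.Eventually.of_forall h0) hf h1

/-- The sum of the centred values of `f` at the samples from state `j`. -/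
noncomputable def centredSum (P : Matrix (Fin n) (Fin n) ℝ) (X : ℕ → Fin n → Ω → Fin n) (T : ℕ)
    (f : Fin n → ℝ) (j : Fin n) (ω : Ω) : ℝ :=
  ∑ t ∈ Finset.range T, (f (X t j ω) - P.mulVec f j)

lemma measurable_centredSum {X : ℕ → Fin n → Ω → Fin n} (hX : ∀ t j, Measurable (X t j))
    (P : Matrix (Fin n) (Fin n) ℝ) (T : ℕ) (f : Fin n → ℝ) (j : Fin n) :
    Measurable (centredSum P X T f j) := by
  unfold centredSum
  exact Finset.measurable_sum _ fun t _ =>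
    (((measurable_of_finite f).comp (hX t j)).sub_const _)

omit [MeasurableSpace Ω] in
lemma empiricalP_mulVec_sub {X : ℕ → Fin n → Ω → Fin n} (P : Matrix (Fin n) (Fin n) ℝ) {T : ℕ}
    (hT : 1 ≤ T) (f : Fin n → ℝ) (j : Fin n) (ω : Ω) :
    (empiricalP (fun t j => X t j ω) T).mulVec f j - P.mulVec f j
      = (T : ℝ)⁻¹ * centredSum P X T f j ω := by
  have hT0 : (T : ℝ) ≠ 0 := by positivity
  rw [empiricalP_mulVec, centredSum, Finset.sum_sub_distrib]
  simp only [Finset.sum_const, Finset.card_range, nsmul_eq_mul]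
  field_simp

omit [MeasurableSpace Ω] in
lemma abs_empiricalP_mulVec_sub_le {X : ℕ → Fin n → Ω → Fin n} {P : Matrix (Fin n) (Fin n) ℝ}
    {T : ℕ} (hT : 1 ≤ T) {f : Fin n → ℝ} {j : Fin n} {ω : Ω} {w B l : ℝ} (hw : 0 ≤ w) (hB : 0 < B)
    (h : bernsteinExponent (T * w) (2 * B) (centredSum P X T f j ω) ≤ l) :
    |(empiricalP (fun t j => X t j ω) T).mulVec f j - P.mulVec f j|
      ≤ 2 * (√w * √(l / T)) + 8 * B * (l / T) := by
  have hT0 : (0 : ℝ) < T := by positivity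
  have h1 := abs_le_of_bernsteinExponent_le (by positivity) (by positivity) h
  rw [empiricalP_mulVec_sub P hT, abs_mul, abs_of_nonneg (by positivity)]
  have h2 : √(T * w * l) = T * (√w * √(l / T)) := by
    have h3 : T * w * l = (T : ℝ) ^ 2 * (w * (l / T)) := by field_simp
    rw [h3, Real.sqrt_mul (by positivity), Real.sqrt_sq hT0.le, Real.sqrt_mul hw]
  calc (T : ℝ)⁻¹ * |centredSum P X T f j ω|
      ≤ (T : ℝ)⁻¹ * (2 * √(T * w * l) + 4 * (2 * B) * l) := by gcongr
    _ = _ := by rw [h2]; field_simp; ring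

lemma measure_le_bernsteinExponent_centredSum_le [IsProbabilityMeasure μ]
    {P : Matrix (Fin n) (Fin n) ℝ} (hP : P ∈ Matrix.rowStochastic ℝ (Fin n))
    {X : ℕ → Fin n → Ω → Fin n} (hX : ∀ t j, Measurable (X t j))
    (hlaw : ∀ t j k, μ (X t j ⁻¹' {k}) = ENNReal.ofReal (P j k))
    (hind : ∀ j, iIndepFun (fun t => X t j) μ) (T : ℕ) {f : Fin n → ℝ} {j : Fin n} {w B l : ℝ}
    (hf : ∀ k, |f k| ≤ B) (hw0 : 0 ≤ w)
    (hw : P.mulVec (fun k => (f k - P.mulVec f j) ^ 2) j ≤ w) (hB : 0 < B) (hl : 0 < l) :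
    μ.real {ω | l ≤ bernsteinExponent (T * w) (2 * B) (centredSum P X T f j ω)}
      ≤ 2 * Real.exp (-l) := by
  have hPf : |P.mulVec f j| ≤ B := by
    refine abs_le.2 ⟨?_, rowStochastic_mulVec_le hP (fun k => (abs_le.1 (hf k)).2) j⟩
    have := rowStochastic_mulVec_le hP (v := -f) (c := B)
      (fun k => by have := (abs_le.1 (hf k)).1; simp only [Pi.neg_apply]; linarith) j
    rw [Matrix.mulVec_neg, Pi.neg_apply] at this
    linarith
  refine measure_le_bernsteinExponent_le (Y := fun t ω => f (X t j ω) - P.mulVec f j)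
    (fun t => ((measurable_of_finite f).comp (hX t j)).sub_const _)
    ((hind j).comp (fun _ k => f k - P.mulVec f j) fun _ => measurable_of_finite _)
    (fun t ω => ?_) (fun t => ?_) (fun t => ?_) hw0 (by positivity) hl
  · have h1 := hf (X t j ω)
    rw [abs_le] at h1 hPf ⊢
    constructor <;> linarith
  · rw [integral_comp_next hP (hX t j) (hlaw t j) (fun k => f k - P.mulVec f j)]
    have : ∀ c, P.mulVec (fun k => f k - c) j = P.mulVec f j - (∑ k, P j k) * c := fun c => by
      simp only [Matrix.mulVec, dotProduct, mul_sub, Finset.sum_sub_distrib, Finset.sum_mul]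
    rw [this, rowStochastic_sum hP]; ring
  · rw [integral_comp_next hP (hX t j) (hlaw t j) (fun k => (f k - P.mulVec f j) ^ 2)]
    exact hw

lemma mulVec_sq_sub {P : Matrix (Fin n) (Fin n) ℝ} (hP : P ∈ Matrix.rowStochastic ℝ (Fin n))
    (f : Fin n → ℝ) (c : ℝ) (j : Fin n) :
    P.mulVec (fun k => (f k - c) ^ 2) j
      = P.mulVec (f ^ 2) j - P.mulVec f j ^ 2 + (P.mulVec f j - c) ^ 2 := by
  have h : P.mulVec (fun k => (f k - c) ^ 2) j
      = P.mulVec (f ^ 2) j - 2 * c * P.mulVec f j + c ^ 2 * ∑ k, P j k := by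
    simp only [Matrix.mulVec, dotProduct, Finset.mul_sum, Pi.pow_apply]
    rw [← Finset.sum_sub_distrib, ← Finset.sum_add_distrib]
    exact Finset.sum_congr rfl fun k _ => by ring
  rw [h, rowStochastic_sum hP]; ring

lemma mulVec_mono {P : Matrix (Fin n) (Fin n) ℝ} (hP : P ∈ Matrix.rowStochastic ℝ (Fin n))
    {f g : Fin n → ℝ} (h : ∀ k, f k ≤ g k) (j : Fin n) : P.mulVec f j ≤ P.mulVec g j := by
  have := rowStochastic_mulVec_nonneg hP (v := g - f) (fun k => by simpa using h k) j
  rw [Matrix.mulVec_sub, Pi.sub_apply] at this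
  linarith

/-- With c the mean of f, f² - c² = (f+c)(f-c) and |f+c| ≤ 2M; centring f² at c² instead of its mean
only increases the second moment. Thus one variance controls both J and J². -/
lemma variance_sq_le {P : Matrix (Fin n) (Fin n) ℝ} (hP : P ∈ Matrix.rowStochastic ℝ (Fin n))
    {f : Fin n → ℝ} {M : ℝ} (hf : ∀ k, |f k| ≤ M) (j : Fin n) :
    P.mulVec (fun k => ((f ^ 2) k - P.mulVec (f ^ 2) j) ^ 2) j
      ≤ (2 * M) ^ 2 * (P.mulVec (f ^ 2) j - P.mulVec f j ^ 2) := by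
  have hPf : |P.mulVec f j| ≤ M := by
    refine abs_le.2 ⟨?_, rowStochastic_mulVec_le hP (fun k => (abs_le.1 (hf k)).2) j⟩
    have := rowStochastic_mulVec_le hP (v := -f) (c := M)
      (fun k => by have := (abs_le.1 (hf k)).1; simp only [Pi.neg_apply]; linarith) j
    rw [Matrix.mulVec_neg, Pi.neg_apply] at this
    linarith
  set c := P.mulVec f j with hc
  have h1 := mulVec_sq_sub hP (f ^ 2) (P.mulVec (f ^ 2) j) j
  have h2 := mulVec_sq_sub hP (f ^ 2) (c ^ 2) j
  have h3 := mulVec_sq_sub hP f c j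
  have h4 : P.mulVec (fun k => ((f ^ 2) k - c ^ 2) ^ 2) j
      ≤ P.mulVec ((2 * M) ^ 2 • fun k => (f k - c) ^ 2) j := by
    refine mulVec_mono hP (fun k => ?_) j
    simp only [Pi.pow_apply, Pi.smul_apply, smul_eq_mul]
    have h5 : (f k + c) ^ 2 ≤ (2 * M) ^ 2 := by
      refine sq_le_sq' ?_ ?_
      · linarith [(abs_le.1 (hf k)).1, (abs_le.1 hPf).1]
      · linarith [(abs_le.1 (hf k)).2, (abs_le.1 hPf).2]
    calc (f k ^ 2 - c ^ 2) ^ 2 = (f k + c) ^ 2 * (f k - c) ^ 2 := by ring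
      _ ≤ _ := by gcongr
  rw [Matrix.mulVec_smul, Pi.smul_apply, smul_eq_mul, h3] at h4
  rw [← hc] at h4
  nlinarith [sq_nonneg (P.mulVec (f ^ 2) j - c ^ 2)]

end Empirical

/-! ### The value function of the empirical chain -/

section EmpiricalValue

variable {n : ℕ} {Ω : Type*} [MeasurableSpace Ω] {μ : Measure Ω} {P : Matrix (Fin n) (Fin n) ℝ}
  {γ : ℝ}

lemma plugIn_eq_valueFunction (hP : P ∈ Matrix.rowStochastic ℝ (Fin n)) (hγ : 0 ≤ γ)
    (hγ1 : γ < 1) (r : Fin n → ℝ) : plugIn γ P r = valueFunction hP γ r := by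
  rw [← plugIn_of_sub_mulVec hP hγ hγ1 (valueFunction hP γ r)]
  congr 1
  funext j
  have := valueFunction_bellman hP hγ hγ1 r j
  linarith

lemma eq_of_mem_rowStochastic_of_subsingleton [Subsingleton (Fin n)] {A : Matrix (Fin n) (Fin n) ℝ}
    (hA : A ∈ Matrix.rowStochastic ℝ (Fin n)) (hP : P ∈ Matrix.rowStochastic ℝ (Fin n)) :
    A = P := by
  ext i j
  have h1 := rowStochastic_sum hA i
  have h2 := rowStochastic_sum hP i
  rw [Fintype.sum_subsingleton _ j] at h1 h2
  rw [h1, h2]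

/-- The expected error of the value function of the empirical chain. -/
lemma integral_norm_plugIn_sub_le_log [IsProbabilityMeasure μ]
    (hP : P ∈ Matrix.rowStochastic ℝ (Fin n)) (hγ : 0 ≤ γ) (hγ1 : γ < 1)
    {X : ℕ → Fin n → Ω → Fin n} (hX : ∀ t j, Measurable (X t j))
    (hlaw : ∀ t j k, μ (X t j ⁻¹' {k}) = ENNReal.ofReal (P j k))
    (hind : ∀ j, iIndepFun (fun t => X t j) μ) {T : ℕ} (hT : 1 ≤ T) {r : Fin n → ℝ} {ρ : ℝ}
    (hr : ∀ j, |r j| ≤ ρ) (hρ : 0 < ρ) (hn : 0 < n) :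
    ∫ ω, ‖plugIn γ (empiricalP (fun t j => X t j ω) T) r - valueFunction hP γ r‖ ∂μ
      ≤ 20 * (ρ / (1 - γ)) * (√((Real.log (4 * n) + 1) / T / (1 - γ))
        + (Real.log (4 * n) + 1) / T / (1 - γ)) := by
  have hg : 0 < 1 - γ := by linarith
  have hT0 : (0 : ℝ) < T := by positivity
  have : Nonempty (Fin n) := ⟨⟨0, hn⟩⟩
  set J := valueFunction hP γ r with hJdef
  set M := ρ / (1 - γ) with hM
  have hM0 : 0 < M := by positivity
  have hJ := valueFunction_bellman hP hγ hγ1 r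
  rw [← hJdef] at hJ
  have hJM : ∀ j, |J j| ≤ M := fun j => by
    refine (norm_le_pi_norm J j).trans ?_
    rw [hJdef, ← plugIn_eq_valueFunction hP hγ hγ1]
    refine (norm_plugIn_le hP hγ hγ1 r).trans ?_
    rw [hM]; gcongr
    exact (pi_norm_le_iff_of_nonneg hρ.le).2 hr
  set v : Fin n → ℝ := fun j => P.mulVec (J ^ 2) j - P.mulVec J j ^ 2 with hv
  have hv0 : ∀ j, 0 ≤ v j := fun j => by
    have h1 := mulVec_sq_sub hP J (P.mulVec J j) j
    have h2 := rowStochastic_mulVec_nonneg hP (v := fun k => (J k - P.mulVec J j) ^ 2)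
      (fun k => sq_nonneg _) j
    rw [h1, sub_self] at h2
    simpa [hv] using h2
  -- One exponent per state for J and one for J². The 2n exponents and the tail constant 2 give the
  -- 4n in the logarithm.
  set Z : Fin n ⊕ Fin n → Ω → ℝ := Sum.elim
    (fun j ω => bernsteinExponent (T * v j) (2 * M) (centredSum P X T J j ω))
    (fun j ω => bernsteinExponent (T * ((2 * M) ^ 2 * v j)) (2 * M ^ 2)
      (centredSum P X T (J ^ 2) j ω)) with hZ
  have hZm : ∀ p, Measurable (Z p) := by
    rintro (j | j) <;>
    exact (measurable_bernsteinExponent _ _).comp (measurable_centredSum hX P T _ j)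
  have hZ0 : ∀ p ω, 0 ≤ Z p ω := by
    rintro (j | j) ω
    · exact bernsteinExponent_nonneg (mul_nonneg hT0.le (hv0 j)) (by positivity) _
    · exact bernsteinExponent_nonneg (mul_nonneg hT0.le (mul_nonneg (sq_nonneg _) (hv0 j)))
        (by positivity) _
  have hZt : ∀ p t, 0 < t → μ.real {ω | t ≤ Z p ω} ≤ 2 * Real.exp (-t) := by
    rintro (j | j) t ht
    · refine measure_le_bernsteinExponent_centredSum_le hP hX hlaw hind T hJM (hv0 j) ?_ hM0 ht
      rw [mulVec_sq_sub hP]; simp [hv]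
    · refine measure_le_bernsteinExponent_centredSum_le hP hX hlaw hind T (fun k => ?_)
        (mul_nonneg (sq_nonneg _) (hv0 j)) (variance_sq_le hP hJM j) (by positivity) ht
      rw [Pi.pow_apply, abs_pow]
      exact pow_le_pow_left₀ (abs_nonneg _) (hJM k) 2
  obtain ⟨hLi, hLe⟩ := integral_iSup_le_log_of_tail hZm hZ0 one_le_two hZt
  set L : Ω → ℝ := fun ω => ⨆ p, Z p ω with hL
  have hL0 : ∀ ω, 0 ≤ L ω := fun ω => Real.iSup_nonneg fun p => hZ0 p ω
  have hcard : ((Fintype.card (Fin n ⊕ Fin n) : ℕ) : ℝ) * 2 = 4 * n := by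
    simp only [Fintype.card_sum, Fintype.card_fin]; push_cast; ring
  rw [hcard] at hLe
  have hbound : ∀ ω, ‖plugIn γ (empiricalP (fun t j => X t j ω) T) r - J‖
      ≤ 20 * M * (√(L ω / T / (1 - γ)) + L ω / T / (1 - γ)) := by
    intro ω
    have hle : ∀ p, Z p ω ≤ L ω := fun p => le_ciSup (Finite.bddAbove_range fun p => Z p ω) p
    have hLω := hL0 ω
    refine (pi_norm_le_iff_of_nonneg (by positivity)).2 fun j => ?_
    refine abs_plugIn_sub_le (empiricalP_mem_rowStochastic _ hT) hγ hγ1 hρ.le hr hM hJM hJ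
      (fun _ => rfl) hv0 (by positivity) (fun j => ?_) (fun j => ?_) j
    · exact abs_empiricalP_mulVec_sub_le hT (hv0 j) hM0 (hle (Sum.inl j))
    · refine (abs_empiricalP_mulVec_sub_le hT (mul_nonneg (sq_nonneg _) (hv0 j)) (by positivity)
        (hle (Sum.inr j))).trans (le_of_eq ?_)
      rw [Real.sqrt_mul (sq_nonneg _), Real.sqrt_sq (by positivity)]
      ring
  have hLi' : Integrable (fun ω => L ω / T / (1 - γ)) μ := (hLi.div_const _).div_const _
  obtain ⟨hSi, hSe⟩ := integral_sqrt_le hLi' (fun ω => by have := hL0 ω; positivity)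
  have hIe : ∫ ω, L ω / T / (1 - γ) ∂μ ≤ (Real.log (4 * n) + 1) / T / (1 - γ) := by
    rw [integral_div, integral_div]; gcongr
  calc _ ≤ ∫ ω, 20 * M * (√(L ω / T / (1 - γ)) + L ω / T / (1 - γ)) ∂μ := by
        refine integral_mono_of_nonneg (Filter.Eventually.of_forall fun ω => norm_nonneg _)
          ((hSi.add hLi').const_mul _) (Filter.Eventually.of_forall hbound)
    _ = 20 * M * (∫ ω, √(L ω / T / (1 - γ)) ∂μ + ∫ ω, L ω / T / (1 - γ) ∂μ) := by
        rw [integral_const_mul, integral_add hSi hLi']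
    _ ≤ _ := by
        gcongr
        exact hSe.trans (Real.sqrt_le_sqrt hIe)

lemma integral_norm_plugIn_sub_le [IsProbabilityMeasure μ]
    (hP : P ∈ Matrix.rowStochastic ℝ (Fin n)) (hγ : 0 ≤ γ) (hγ1 : γ < 1)
    {X : ℕ → Fin n → Ω → Fin n} (hX : ∀ t j, Measurable (X t j))
    (hlaw : ∀ t j k, μ (X t j ⁻¹' {k}) = ENNReal.ofReal (P j k))
    (hind : ∀ j, iIndepFun (fun t => X t j) μ) {T : ℕ} (hT : 1 ≤ T) {r : Fin n → ℝ} {ρ : ℝ}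
    (hr : ∀ j, |r j| ≤ ρ) :
    ∫ ω, ‖plugIn γ (empiricalP (fun t j => X t j ω) T) r - valueFunction hP γ r‖ ∂μ
      ≤ 100 * (ρ * √(Real.log n) / ((1 - γ) ^ (3 / 2 : ℝ) * √T)
        + ρ * Real.log n / ((1 - γ) ^ 2 * T)) := by
  have hg : 0 < 1 - γ := by linarith
  have hT0 : (0 : ℝ) < T := by positivity
  rcases Nat.lt_or_ge n 2 with hn | hn
  -- Here log n = 0, so the error must vanish exactly; it does, since there is at most one
  -- stochastic matrix of this size.
  · have : Subsingleton (Fin n) := by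
      have : n = 0 ∨ n = 1 := by omega
      rcases this with rfl | rfl <;> infer_instance
    have h0 : ∀ ω, plugIn γ (empiricalP (fun t j => X t j ω) T) r = valueFunction hP γ r :=
      fun ω => by
        rw [eq_of_mem_rowStochastic_of_subsingleton (empiricalP_mem_rowStochastic _ hT) hP,
          plugIn_eq_valueFunction hP hγ hγ1]
    have hlog : Real.log n = 0 := by
      have : n = 0 ∨ n = 1 := by omega
      rcases this with rfl | rfl <;> simp
    simp [h0, hlog]
  have hρ : 0 ≤ ρ := (abs_nonneg _).trans (hr ⟨0, by omega⟩)
  have hl2 : Real.log 2 ≤ Real.log n := Real.log_le_log (by norm_num) (by exact_mod_cast hn)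
  have hl2' := Real.log_two_gt_d9
  have hl0 : 0 < Real.log n := by linarith
  rcases hρ.eq_or_lt with h0 | h0
  · have hr0 : r = 0 := by
      funext j; exact abs_eq_zero.1 (le_antisymm (h0 ▸ hr j) (abs_nonneg _))
    have h1 : ∀ ω, plugIn γ (empiricalP (fun t j => X t j ω) T) r = valueFunction hP γ r :=
      fun ω => by
        rw [← plugIn_eq_valueFunction hP hγ hγ1, hr0]; simp [plugIn]
    simp [h1, ← h0]
  refine (integral_norm_plugIn_sub_le_log hP hγ hγ1 hX hlaw hind hT hr h0 (by omega)).trans ?_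
  -- For n ≥ 2, log 4 ≤ 2 log n and 1 ≤ 2 log 2 ≤ 2 log n.
  have h4 : Real.log (4 * n) + 1 ≤ 5 * Real.log n := by
    have hn0 : (n : ℝ) ≠ 0 := by positivity
    rw [Real.log_mul (by norm_num) hn0, show (4 : ℝ) = 2 ^ 2 by norm_num, Real.log_pow]
    push_cast; linarith
  have h5 : √((Real.log (4 * n) + 1) / T / (1 - γ)) ≤ 5 * (√(Real.log n) / (√(1 - γ) * √T)) := by
    refine Real.sqrt_le_iff.2 ⟨by positivity, ?_⟩
    rw [mul_pow, div_pow, mul_pow, Real.sq_sqrt hl0.le, Real.sq_sqrt hg.le, Real.sq_sqrt hT0.le,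
      div_div, mul_comm (T : ℝ), mul_div_assoc']
    gcongr
    linarith
  have h6 : (1 - γ) ^ (3 / 2 : ℝ) = (1 - γ) * √(1 - γ) := by
    rw [show (3 / 2 : ℝ) = 1 + 1 / 2 by norm_num, Real.rpow_add hg, Real.rpow_one,
      Real.sqrt_eq_rpow]
  have h7 : (Real.log (4 * n) + 1) / T / (1 - γ) ≤ 5 * (Real.log n / (T * (1 - γ))) := by
    rw [div_div, mul_div_assoc']; gcongr
  calc _ ≤ 20 * (ρ / (1 - γ)) * (5 * (√(Real.log n) / (√(1 - γ) * √T))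
        + 5 * (Real.log n / (T * (1 - γ)))) := by gcongr
    _ = _ := by rw [h6]; field_simp; ring

end EmpiricalValue

/-! ### The modes of a gossip matrix -/

section Modes

variable {N : ℕ} {G : SimpleGraph (Fin N)} {L : Matrix (Fin N) (Fin N) ℝ}

lemma exists_spec_eq_eigenvalues (hL : L.IsHermitian) :
    ∃ e : Fin N ≃ Fin N, ∀ k, hL.eigenvalues k = spec hL (e k) :=
  ⟨(Fintype.equivOfCardEq (Fintype.card_fin _)).symm.trans (finCongr (Fintype.card_fin N)),
    fun _ => rfl⟩

lemma spec_antitone (hL : L.IsHermitian) : Antitone (spec hL) := fun _ _ h =>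
  hL.eigenvalues₀_antitone h

lemma sum_eigenvectorBasis_mul_eq_inner (hL : L.IsHermitian) (k : Fin N) (w : Fin N → ℝ) :
    ∑ i, hL.eigenvectorBasis k i * w i
      = inner ℝ (hL.eigenvectorBasis k) (WithLp.toLp 2 w) := by
  rw [PiLp.inner_apply]
  exact Finset.sum_congr rfl fun i _ => by simp [mul_comm]

lemma sum_sq_modes (hL : L.IsHermitian) (w : Fin N → ℝ) :
    ∑ k, (∑ i, hL.eigenvectorBasis k i * w i) ^ 2 = ∑ i, w i ^ 2 := by
  have h := hL.eigenvectorBasis.sum_sq_norm_inner_right (WithLp.toLp 2 w)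
  rw [EuclideanSpace.norm_sq_eq] at h
  simpa only [sum_eigenvectorBasis_mul_eq_inner, Real.norm_eq_abs, sq_abs] using h

lemma sum_modes (hL : L.IsHermitian) (w : Fin N → ℝ) (i : Fin N) :
    ∑ k, hL.eigenvectorBasis k i * ∑ i', hL.eigenvectorBasis k i' * w i' = w i := by
  have h := congrArg (fun x : EuclideanSpace ℝ (Fin N) => x i)
    (hL.eigenvectorBasis.sum_repr' (WithLp.toLp 2 w))
  simp only [sum_eigenvectorBasis_mul_eq_inner]
  simpa [mul_comm] using h

lemma sum_sq_eigenvectorBasis_apply (hL : L.IsHermitian) (i : Fin N) :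
    ∑ k, hL.eigenvectorBasis k i ^ 2 = 1 := by
  have h := sum_modes hL (Pi.single i 1) i
  simpa [Pi.single_apply, sq] using h

lemma sum_eigenvectorBasis_mul_mulVec (hL : L.IsHermitian) (k : Fin N) (w : Fin N → ℝ) :
    ∑ i, hL.eigenvectorBasis k i * L.mulVec w i
      = hL.eigenvalues k * ∑ i, hL.eigenvectorBasis k i * w i := by
  have h1 := Matrix.dotProduct_mulVec (hL.eigenvectorBasis k : Fin N → ℝ) L w
  have h2 : Matrix.vecMul (hL.eigenvectorBasis k : Fin N → ℝ) L
      = hL.eigenvalues k • (hL.eigenvectorBasis k : Fin N → ℝ) := by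
    rw [← hL.mulVec_eigenvectorBasis k, ← Matrix.vecMul_transpose]
    congr 1
    have := hL.eq
    rwa [Matrix.conjTranspose_eq_transpose_of_trivial, eq_comm] at this
  rw [h2] at h1
  simp only [dotProduct, Pi.smul_apply, smul_eq_mul, mul_assoc] at h1
  rw [h1, Finset.mul_sum]

/-- The modes of a gossip matrix: the constant mode `k₀`, with eigenvalue zero, and the other modes,
with eigenvalues between `λ_1(L) / κ` and `λ_1(L)`. -/
lemma exists_consensus_mode (hL : IsGossipMatrix G L) (hN : 2 ≤ N) :
    1 ≤ kappa hL.posSemidef.isHermitian hN ∧ 0 < lambdaOne hL.posSemidef.isHermitian hN ∧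
    ∃ k₀ : Fin N, hL.posSemidef.isHermitian.eigenvalues k₀ = 0 ∧
      (∃ c : ℝ, N * c ^ 2 = 1 ∧ ∀ i, hL.posSemidef.isHermitian.eigenvectorBasis k₀ i = c) ∧
      ∀ k, k ≠ k₀ → ∑ i, hL.posSemidef.isHermitian.eigenvectorBasis k i = 0 ∧
        (kappa hL.posSemidef.isHermitian hN)⁻¹
          ≤ 1 / lambdaOne hL.posSemidef.isHermitian hN * hL.posSemidef.isHermitian.eigenvalues k ∧
        1 / lambdaOne hL.posSemidef.isHermitian hN * hL.posSemidef.isHermitian.eigenvalues k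
          ≤ 1 := by
  set H := hL.posSemidef.isHermitian
  have hnn : ∀ k, 0 ≤ H.eigenvalues k := fun k => hL.posSemidef.eigenvalues_nonneg k
  have hN0 : (0 : ℝ) < N := by positivity
  -- eigenvectors for the eigenvalue zero are constant
  have hconst : ∀ k, H.eigenvalues k = 0 →
      ∃ c : ℝ, N * c ^ 2 = 1 ∧ ∀ i, H.eigenvectorBasis k i = c := by
    intro k hk
    have h1 := H.mulVec_eigenvectorBasis k
    rw [hk, zero_smul] at h1
    obtain ⟨c, hc⟩ := (hL.ker _).1 h1
    refine ⟨c, ?_, fun i => congrFun hc i⟩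
    have h2 := EuclideanSpace.norm_sq_eq (H.eigenvectorBasis k)
    rw [H.eigenvectorBasis.norm_eq_one] at h2
    simp only [fun i => congrFun hc i, Real.norm_eq_abs, sq_abs] at h2
    simpa using h2.symm
  -- Otherwise the all-ones vector, which lies in the kernel, would be orthogonal to the whole
  -- eigenbasis.
  obtain ⟨k₀, hk₀⟩ : ∃ k₀, H.eigenvalues k₀ = 0 := by
    by_contra! hne
    have h1 : ∀ k, ∑ i, H.eigenvectorBasis k i * (1 : ℝ) = 0 := by
      intro k
      have h2 := sum_eigenvectorBasis_mul_mulVec H k (fun _ => 1)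
      rw [(hL.ker _).2 ⟨1, rfl⟩] at h2
      simp only [Pi.zero_apply, mul_zero, Finset.sum_const_zero] at h2
      exact (mul_eq_zero.1 h2.symm).resolve_left (hne k)
    have h3 := sum_modes H (fun _ => 1) ⟨0, by omega⟩
    simp only [h1, mul_zero, Finset.sum_const_zero, zero_ne_one] at h3
  obtain ⟨c, hc1, hc⟩ := hconst k₀ hk₀
  have hc0 : c ≠ 0 := by rintro rfl; simp at hc1
  have horth : ∀ k, k ≠ k₀ → ∑ i, H.eigenvectorBasis k i = 0 := by
    intro k hk
    have h1 := sum_eigenvectorBasis_mul_eq_inner H k (H.eigenvectorBasis k₀)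
    rw [show WithLp.toLp 2 (H.eigenvectorBasis k₀ : Fin N → ℝ) = H.eigenvectorBasis k₀ from rfl,
      H.eigenvectorBasis.inner_eq_zero hk] at h1
    simp only [hc, ← Finset.sum_mul] at h1
    exact (mul_eq_zero.1 h1).resolve_right hc0
  have hne : ∀ k, k ≠ k₀ → H.eigenvalues k ≠ 0 := by
    intro k hk hk0
    obtain ⟨c', hc1', hc'⟩ := hconst k hk0
    have h1 := horth k hk
    simp only [hc', Finset.sum_const, Finset.card_univ, Fintype.card_fin, nsmul_eq_mul] at h1
    have h2 : c' = 0 := (mul_eq_zero.1 h1).resolve_left hN0.ne'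
    simp [h2] at hc1'
  obtain ⟨e, he⟩ := exists_spec_eq_eigenvalues H
  have hspec : ∀ a, spec H a = H.eigenvalues (e.symm a) := fun a => by rw [he, e.apply_symm_apply]
  -- The zero eigenvalue is simple and smallest, hence last; every other mode sits at position at
  -- most N - 2, whose eigenvalue is the denominator of κ.
  have hlast : e k₀ = ⟨N - 1, by omega⟩ := by
    have h1 : spec H ⟨N - 1, by omega⟩ ≤ spec H (e k₀) :=
      spec_antitone H (Fin.mk_le_mk.2 (by omega) : e k₀ ≤ ⟨N - 1, by omega⟩)
    rw [← he, hk₀, hspec] at h1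
    by_contra hcon
    refine hne (e.symm ⟨N - 1, by omega⟩) (fun h => hcon ?_) (le_antisymm h1 (hnn _))
    rw [← h, e.apply_symm_apply]
  set b : Fin N := ⟨N - 2, by omega⟩ with hb
  have hb0 : 0 < spec H b := by
    rw [hspec]
    refine lt_of_le_of_ne (hnn _) (Ne.symm (hne _ fun h => ?_))
    rw [← h, e.apply_symm_apply, hb, Fin.mk.injEq] at hlast
    omega
  have hl1 : ∀ a, spec H a ≤ lambdaOne H hN := fun a =>
    spec_antitone H (Fin.mk_le_mk.2 (Nat.zero_le _) : (⟨0, by omega⟩ : Fin N) ≤ a)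
  have hl0 : 0 < lambdaOne H hN := hb0.trans_le (hl1 b)
  refine ⟨?_, hl0, k₀, hk₀, ⟨c, hc1, hc⟩, fun k hk => ⟨horth k hk, ?_, ?_⟩⟩
  · rw [kappa, one_le_div hb0]; exact hl1 b
  · rw [kappa, inv_div, one_div, inv_mul_eq_div]
    gcongr
    rw [he]
    refine spec_antitone H ?_
    have h1 : e k ≠ ⟨N - 1, by omega⟩ := fun h => hk (e.injective (h.trans hlast.symm))
    have h2 : (e k : ℕ) ≠ N - 1 := fun h => h1 (Fin.ext h)
    change (e k : ℕ) ≤ N - 2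
    omega
  · rw [one_div, inv_mul_le_one₀ hl0, he]; exact hl1 _

end Modes

/-! ### The output in the modes -/

section ModeOutput

variable {N n : ℕ} {G : SimpleGraph (Fin N)} [DecidableRel G.Adj] {L : Matrix (Fin N) (Fin N) ℝ}

lemma gossipStep_apply (hL : IsGossipMatrix G L) (η : ℝ) (x θ : Fin N → Fin n → ℝ) (i : Fin N)
    (j : Fin n) : gossipStep G L η x θ i j = x i j - η * L.mulVec (fun i' => θ i' j) i := by
  simp only [gossipStep, Pi.sub_apply, Pi.smul_apply, Finset.sum_apply, smul_eq_mul, Matrix.mulVec,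
    dotProduct]
  congr 2
  refine Finset.sum_subset (Finset.subset_univ _) fun i' _ hi' => ?_
  have : L i i' = 0 := by
    by_contra h0
    refine hi' (Finset.mem_insert.2 ?_)
    rcases hL.support i i' h0 with h | h
    · exact Or.inl h.symm
    · exact Or.inr ((G.mem_neighborFinset i i').2 h)
  rw [this, zero_mul]

/-- The weight of the input at time `s` in the sum of `θ` over the times `T₀, …, T - 1`. -/
noncomputable def modeWeight (h ζ : ℝ) (T₀ T s : ℕ) : ℝ :=
  stepResponse h ζ (T - 1 - s) - if s < T₀ then stepResponse h ζ (T₀ - 1 - s) else 0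

lemma sum_modeWeight_mul {h ζ : ℝ} {T₀ T : ℕ} (hT : T₀ ≤ T) (d : ℕ → ℝ) :
    ∑ s ∈ Finset.range T, modeWeight h ζ T₀ T s * d s
      = ∑ s ∈ Finset.range T, stepResponse h ζ (T - 1 - s) * d s
        - ∑ s ∈ Finset.range T₀, stepResponse h ζ (T₀ - 1 - s) * d s := by
  simp only [modeWeight, sub_mul, Finset.sum_sub_distrib, ite_mul, zero_mul]
  congr 1
  rw [← Finset.sum_filter]
  congr 1
  ext s
  simp only [Finset.mem_filter, Finset.mem_range]
  omega

/-- The response to constant input, which is the mean of the output and hence the bias. -/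
lemma sum_modeWeight (h ζ : ℝ) {T₀ T : ℕ} (hT : T₀ ≤ T) :
    ∑ s ∈ Finset.range T, modeWeight h ζ T₀ T s = ∑ t ∈ Finset.Ico T₀ T, stepResponse h ζ t := by
  have h1 := sum_modeWeight_mul (h := h) (ζ := ζ) hT (fun _ => 1)
  simp only [mul_one] at h1
  rw [h1, Finset.sum_range_reflect (stepResponse h ζ), Finset.sum_range_reflect (stepResponse h ζ),
    Finset.sum_Ico_eq_sub _ hT]

lemma sum_modeWeight_sq_le (h ζ : ℝ) {T₀ T : ℕ} (hT : T₀ ≤ T) :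
    ∑ s ∈ Finset.range T, modeWeight h ζ T₀ T s ^ 2
      ≤ 4 * ∑ t ∈ Finset.range T, stepResponse h ζ t ^ 2 := by
  have h1 : ∀ s ∈ Finset.range T, modeWeight h ζ T₀ T s ^ 2
      ≤ 2 * stepResponse h ζ (T - 1 - s) ^ 2
        + 2 * if s < T₀ then stepResponse h ζ (T₀ - 1 - s) ^ 2 else 0 := by
    intro s _
    unfold modeWeight
    split_ifs
    · nlinarith [sq_nonneg (stepResponse h ζ (T - 1 - s) + stepResponse h ζ (T₀ - 1 - s))]
    · nlinarith [sq_nonneg (stepResponse h ζ (T - 1 - s))]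
  refine (Finset.sum_le_sum h1).trans ?_
  rw [Finset.sum_add_distrib, ← Finset.mul_sum, ← Finset.mul_sum,
    Finset.sum_range_reflect (fun t => stepResponse h ζ t ^ 2), ← Finset.sum_filter]
  have h2 : (Finset.range T).filter (· < T₀) = Finset.range T₀ := by
    ext s; simp only [Finset.mem_filter, Finset.mem_range]; omega
  rw [h2, Finset.sum_range_reflect (fun t => stepResponse h ζ t ^ 2)]
  have h3 : ∑ t ∈ Finset.range T₀, stepResponse h ζ t ^ 2
      ≤ ∑ t ∈ Finset.range T, stepResponse h ζ t ^ 2 :=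
    Finset.sum_le_sum_of_subset_of_nonneg (Finset.range_subset_range.2 hT) fun _ _ _ => sq_nonneg _
  linarith

/-- Pairing the recursion with a left eigenvector u of L turns the gossip step into multiplication
by η·a, so each mode evolves as a scalar recursion. -/
lemma sum_mul_output (hL : IsGossipMatrix G L) (η ζ : ℝ) (R : Fin N → ℕ → Fin n → ℝ) {T₀ T : ℕ}
    (hT : T₀ ≤ T) (j : Fin n) {u : Fin N → ℝ} {a : ℝ}
    (hu : ∀ w, ∑ i, u i * L.mulVec w i = a * ∑ i, u i * w i) :
    ∑ i, u i * output G L η ζ R T₀ T i j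
      = ((T : ℝ) - T₀)⁻¹ * ∑ s ∈ Finset.range T,
          modeWeight (η * a) ζ T₀ T s * ∑ i, u i * R i s j := by
  set x : ℕ → ℝ := fun t => ∑ i, u i * (state G L η ζ R t).1 i j with hx
  set y : ℕ → ℝ := fun t => ∑ i, u i * (state G L η ζ R t).2 i j with hy
  set d : ℕ → ℝ := fun t => ∑ i, u i * R i t j with hd
  have hys : ∀ t, y (t + 1) = x t - η * a * (x t + d t) := by
    intro t
    simp only [hy, hx, hd, state, gossipStep_apply hL, mul_sub, Finset.sum_sub_distrib]
    congr 1
    have h1 := hu (fun i' => (state G L η ζ R t).1 i' j + R i' t j)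
    simp only [mul_add, Finset.sum_add_distrib] at h1
    rw [mul_assoc, mul_add, ← h1, Finset.mul_sum]
    exact Finset.sum_congr rfl fun i _ => mul_left_comm _ _ _
  have hxs : ∀ t, x (t + 1) = y (t + 1) + ζ * (y (t + 1) - y t) := by
    intro t
    simp only [hy, hx, state, Pi.add_apply, Pi.smul_apply, Pi.sub_apply, smul_eq_mul]
    rw [← Finset.sum_sub_distrib, Finset.mul_sum, ← Finset.sum_add_distrib]
    exact Finset.sum_congr rfl fun i _ => by ring
  have hconv := sum_theta_eq_convolution (h := η * a) (ζ := ζ) (x := x) (y := y) (d := d)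
    (by simp [hx, state]) (by simp [hy, state]) hys hxs
  rw [sum_modeWeight_mul hT, ← hconv, ← hconv, ← Finset.sum_Ico_eq_sub _ hT, Finset.mul_sum]
  simp only [output, theta, Pi.smul_apply, Finset.sum_apply, Pi.add_apply, smul_eq_mul, hx, hd]
  simp only [← Finset.sum_add_distrib, ← mul_add]
  rw [← Finset.mul_sum, Finset.sum_comm, Finset.mul_sum]
  refine Finset.sum_congr rfl fun i _ => ?_
  rw [← Finset.mul_sum, mul_left_comm]

end ModeOutput

/-! ### Second moments of the output -/

section Moments

variable {N n : ℕ} {Ω : Type*} [MeasurableSpace Ω] {μ : Measure Ω} [IsProbabilityMeasure μ]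

lemma integral_sub_sq {Y : Ω → ℝ} (hY : MemLp Y 2 μ) (b : ℝ) :
    ∫ ω, (Y ω - b) ^ 2 ∂μ = (∫ ω, Y ω ∂μ - b) ^ 2 + Var[Y; μ] := by
  have h1 : Integrable Y μ := hY.integrable one_le_two
  have h2 : Integrable (fun ω => Y ω ^ 2) μ := hY.integrable_sq
  have h3 : ∀ ω, (Y ω - b) ^ 2 = Y ω ^ 2 - (2 * b * Y ω - b ^ 2) := fun ω => by ring
  have h4 : Integrable (fun ω => 2 * b * Y ω - b ^ 2) μ :=
    (h1.const_mul _).sub (integrable_const _)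
  simp only [h3]
  rw [integral_sub h2 h4, integral_sub (h1.const_mul _) (integrable_const _), integral_const_mul,
    variance_eq_sub hY]
  simp only [integral_const, probReal_univ, smul_eq_mul, one_mul, Pi.pow_apply]
  ring

variable {P : Matrix (Fin n) (Fin n) ℝ} {r σ : Fin N → Fin n → ℝ} {X : ℕ → Fin n → Ω → Fin n}
  {R : Fin N → ℕ → Ω → Fin n → ℝ}

omit [IsProbabilityMeasure μ] in
lemma memLp_sum_reward (h : IsGenerativeModel μ P r σ X R) (S : Finset (Fin N × ℕ))
    (a : Fin N × ℕ → ℝ) (j : Fin n) :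
    MemLp (fun ω => ∑ p ∈ S, a p * R p.1 p.2 ω j) 2 μ :=
  memLp_finsetSum S fun p _ => (h.memLp_reward p.1 p.2 j).const_mul (a p)

lemma integral_sum_reward (h : IsGenerativeModel μ P r σ X R) (S : Finset (Fin N × ℕ))
    (a : Fin N × ℕ → ℝ) (j : Fin n) :
    ∫ ω, ∑ p ∈ S, a p * R p.1 p.2 ω j ∂μ = ∑ p ∈ S, a p * r p.1 j := by
  rw [integral_finsetSum _ fun p _ =>
    ((h.memLp_reward p.1 p.2 j).integrable one_le_two).const_mul (a p)]
  simp only [integral_const_mul, h.mean_reward]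

omit [IsProbabilityMeasure μ] in
lemma variance_sum_reward (h : IsGenerativeModel μ P r σ X R) (S : Finset (Fin N × ℕ))
    (a : Fin N × ℕ → ℝ) (j : Fin n) :
    Var[fun ω => ∑ p ∈ S, a p * R p.1 p.2 ω j; μ] = ∑ p ∈ S, a p ^ 2 * σ p.1 j ^ 2 := by
  have hind : iIndepFun (fun (p : Fin N × ℕ) ω => a p * R p.1 p.2 ω j) μ :=
    h.indep_reward.comp (fun p (v : Fin n → ℝ) => a p * v j)
      fun p => (measurable_pi_apply j).const_mul _
  have h1 := IndepFun.variance_sum (μ := μ) (s := S)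
    (X := fun (p : Fin N × ℕ) ω => a p * R p.1 p.2 ω j)
    (fun p _ => (h.memLp_reward p.1 p.2 j).const_mul (a p))
    (fun p _ p' _ hp => hind.indepFun hp)
  rw [show (∑ p ∈ S, fun ω => a p * R p.1 p.2 ω j) = fun ω => ∑ p ∈ S, a p * R p.1 p.2 ω j by
    funext ω; simp] at h1
  rw [h1]
  refine Finset.sum_congr rfl fun p _ => ?_
  rw [variance_const_mul, h.variance_reward]

variable {G : SimpleGraph (Fin N)} [DecidableRel G.Adj] {L : Matrix (Fin N) (Fin N) ℝ}

/-- The second moment of a mode of the output around `b`. -/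
lemma integral_sum_mul_output_sub_sq (h : IsGenerativeModel μ P r σ X R)
    (hL : IsGossipMatrix G L) (η ζ : ℝ) {T₀ T : ℕ} (hT : T₀ ≤ T) (j : Fin n) {u : Fin N → ℝ}
    {a : ℝ} (hu : ∀ w, ∑ i, u i * L.mulVec w i = a * ∑ i, u i * w i) (b : ℝ) :
    Integrable (fun ω =>
      (∑ i, u i * output G L η ζ (fun i t => R i t ω) T₀ T i j - b) ^ 2) μ ∧
    ∫ ω, (∑ i, u i * output G L η ζ (fun i t => R i t ω) T₀ T i j - b) ^ 2 ∂μ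
      = (((T : ℝ) - T₀)⁻¹ * (∑ t ∈ Finset.Ico T₀ T, stepResponse (η * a) ζ t) * ∑ i, u i * r i j
          - b) ^ 2
        + (((T : ℝ) - T₀)⁻¹) ^ 2 * ((∑ s ∈ Finset.range T, modeWeight (η * a) ζ T₀ T s ^ 2)
          * ∑ i, u i ^ 2 * σ i j ^ 2) := by
  set m := ((T : ℝ) - T₀)⁻¹
  set S : Finset (Fin N × ℕ) := Finset.univ ×ˢ Finset.range T
  set c : Fin N × ℕ → ℝ := fun p => m * modeWeight (η * a) ζ T₀ T p.2 * u p.1 with hc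
  have hsum : ∀ (g : Fin N → ℕ → ℝ),
      m * ∑ s ∈ Finset.range T, modeWeight (η * a) ζ T₀ T s * ∑ i, u i * g i s
        = ∑ p ∈ S, c p * g p.1 p.2 := by
    intro g
    rw [Finset.sum_product_right, Finset.mul_sum]
    refine Finset.sum_congr rfl fun s _ => ?_
    rw [Finset.mul_sum, Finset.mul_sum]
    exact Finset.sum_congr rfl fun i _ => by simp only [hc]; ring
  have hY : ∀ ω, ∑ i, u i * output G L η ζ (fun i t => R i t ω) T₀ T i j
      = ∑ p ∈ S, c p * R p.1 p.2 ω j := fun ω => by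
    rw [sum_mul_output hL η ζ _ hT j hu, hsum (fun i s => R i s ω j)]
  simp only [hY]
  have hmem := memLp_sum_reward h S c j
  refine ⟨(hmem.sub (memLp_const b)).integrable_sq, ?_⟩
  rw [integral_sub_sq hmem, integral_sum_reward h, variance_sum_reward h]
  congr 2
  · rw [← hsum (fun i _ => r i j), ← Finset.sum_mul, sum_modeWeight _ _ hT, mul_assoc]
  · rw [Finset.sum_product_right, Finset.sum_mul, Finset.mul_sum]
    refine Finset.sum_congr rfl fun s _ => ?_
    rw [Finset.mul_sum, Finset.mul_sum]
    exact Finset.sum_congr rfl fun i _ => by simp only [hc]; ring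

end Moments

/-! ### The error of the tuned output -/

section TunedOutput

variable {N n : ℕ} {Ω : Type*} [MeasurableSpace Ω] {μ : Measure Ω}
  {P : Matrix (Fin n) (Fin n) ℝ} {r σ : Fin N → Fin n → ℝ} {X : ℕ → Fin n → Ω → Fin n}
  {R : Fin N → ℕ → Ω → Fin n → ℝ}
  {G : SimpleGraph (Fin N)} [DecidableRel G.Adj] {L : Matrix (Fin N) (Fin N) ℝ}

lemma measurable_state (hR : ∀ i t, Measurable (R i t)) (η ζ : ℝ) (t : ℕ) (i : Fin N) :
    (Measurable fun ω => (state G L η ζ (fun i t => R i t ω) t).1 i) ∧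
      Measurable fun ω => (state G L η ζ (fun i t => R i t ω) t).2 i := by
  induction t generalizing i with
  | zero => exact ⟨measurable_const, measurable_const⟩
  | succ t ih =>
    have h1 : ∀ i, Measurable fun ω => gossipStep G L η
        (state G L η ζ (fun i t => R i t ω) t).1
        (fun j => (state G L η ζ (fun i t => R i t ω) t).1 j + R j t ω) i := fun i =>
      (ih i).1.sub ((Finset.measurable_sum _ fun j _ =>
        ((ih j).1.add (hR j t)).const_smul (L i j)).const_smul η)
    exact ⟨(h1 i).add (((h1 i).sub (ih i).2).const_smul ζ), h1 i⟩

lemma measurable_output (hR : ∀ i t, Measurable (R i t)) (η ζ : ℝ) (T₀ T : ℕ) (i : Fin N) :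
    Measurable fun ω => output G L η ζ (fun i t => R i t ω) T₀ T i := by
  have h1 : Measurable fun ω =>
      ∑ t ∈ Finset.Ico T₀ T, theta G L η ζ (fun i t => R i t ω) i t :=
    Finset.measurable_sum _ fun t _ => (measurable_state hR η ζ t i).1.add (hR i t)
  exact h1.const_smul ((T : ℝ) - (T₀ : ℝ))⁻¹

omit [DecidableRel G.Adj] in
/-- A vector is controlled by its modes, the constant mode being spread over all the agents. -/
lemma sq_le_sum_sq_modes (hL : L.IsHermitian) {k₀ : Fin N} {c : ℝ}
    (hc : ∀ i, hL.eigenvectorBasis k₀ i = c) (w : Fin N → ℝ) (i : Fin N) :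
    w i ^ 2 ≤ 2 * (c ^ 2 * (∑ i', hL.eigenvectorBasis k₀ i' * w i') ^ 2)
      + 2 * ∑ k ∈ Finset.univ.erase k₀, (∑ i', hL.eigenvectorBasis k i' * w i') ^ 2 := by
  set W : Fin N → ℝ := fun k => ∑ i', hL.eigenvectorBasis k i' * w i' with hW
  have h1 : w i = c * W k₀ + ∑ k ∈ Finset.univ.erase k₀, hL.eigenvectorBasis k i * W k := by
    rw [← hc i, Finset.add_sum_erase _ (fun k => hL.eigenvectorBasis k i * W k)
      (Finset.mem_univ k₀)]
    exact (sum_modes hL w i).symm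
  -- Cauchy–Schwarz: the i-th coordinates of the eigenbasis have squares summing to 1.
  have h2 : (∑ k ∈ Finset.univ.erase k₀, hL.eigenvectorBasis k i * W k) ^ 2
      ≤ ∑ k ∈ Finset.univ.erase k₀, W k ^ 2 := by
    refine (Finset.sum_mul_sq_le_sq_mul_sq _ _ _).trans ?_
    have h3 : ∑ k ∈ Finset.univ.erase k₀, hL.eigenvectorBasis k i ^ 2 ≤ 1 := by
      rw [← sum_sq_eigenvectorBasis_apply hL i]
      exact Finset.sum_le_sum_of_subset_of_nonneg (Finset.erase_subset _ _)
        fun _ _ _ => sq_nonneg _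
    exact mul_le_of_le_one_left (Finset.sum_nonneg fun _ _ => sq_nonneg _) h3
  rw [h1]
  nlinarith [sq_nonneg (c * W k₀ - ∑ k ∈ Finset.univ.erase k₀, hL.eigenvectorBasis k i * W k)]

/-- A random variable whose square root dominates the error of the tuned output. -/
lemma exists_sq_error_bound [IsProbabilityMeasure μ] (h : IsGenerativeModel μ P r σ X R)
    (hL : IsGossipMatrix G L) (hN : 2 ≤ N) {T : ℕ} (hT : 1 ≤ T) :
    ∃ D : Ω → ℝ, Integrable D μ ∧ (∀ ω, 0 ≤ D ω) ∧
      (∀ ω i j, (tunedOutput G hL.posSemidef.isHermitian hN (fun i t => R i t ω) T i j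
        - avg r j) ^ 2 ≤ D ω) ∧
      ∫ ω, D ω ∂μ ≤ 4 * (∑ j, ⨆ i, σ i j ^ 2) / T
        + 128 * Real.exp (-(T : ℝ) / (2 * √(kappa hL.posSemidef.isHermitian hN))) ^ 2
          * ∑ i, ∑ j, (r i j - avg r j) ^ 2
        + 1024 * √(kappa hL.posSemidef.isHermitian hN) * (∑ i, ∑ j, σ i j ^ 2) / T ^ 2 := by
  obtain ⟨hκ, hl1, k₀, hk₀, ⟨c, hc1, hc⟩, hmodes⟩ := exists_consensus_mode hL hN
  set H := hL.posSemidef.isHermitian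
  set κ := kappa H hN with hκdef
  set η := 1 / lambdaOne H hN with hη
  set ζ := (√κ - 1) / (√κ + 1) with hζ
  -- Then q² is the smallest nonzero eigenvalue of ηL, the critically damped one.
  set q := 1 / √κ with hq
  have hsκ : 1 ≤ √κ := Real.one_le_sqrt.2 hκ
  have hsκ0 : 0 < √κ := by linarith
  have hq0 : 0 < q := by positivity
  have hq1 : q ≤ 1 := by rw [hq, div_le_one hsκ0]; exact hsκ
  have hζq : ζ = (1 - q) / (1 + q) := by rw [hζ, hq]; field_simp
  have hq2 : q ^ 2 = κ⁻¹ := by rw [hq, div_pow, Real.sq_sqrt (by linarith)]; simp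
  have hN0 : (0 : ℝ) < N := by positivity
  have hT0 : (0 : ℝ) < T := by positivity
  set T₀ := T / 2 with hT₀
  have hTT : T₀ ≤ T := by omega
  set m := (T : ℝ) - T₀ with hm
  have hmN : ((T - T₀ : ℕ) : ℝ) = m := by rw [Nat.cast_sub hTT]
  have hmT : (T : ℝ) ≤ 2 * m := by
    rw [← hmN]; have : T ≤ 2 * (T - T₀) := by omega
    exact_mod_cast this
  have hm0 : 0 < m := by linarith
  set O : Ω → Fin N → Fin n → ℝ := fun ω i =>
    tunedOutput G H hN (fun i t => R i t ω) T i with hO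
  set W : Fin N → Fin n → Ω → ℝ := fun k j ω =>
    ∑ i, H.eigenvectorBasis k i * O ω i j - ∑ i, H.eigenvectorBasis k i * avg r j with hW
  have hmom : ∀ k j, Integrable (fun ω => W k j ω ^ 2) μ ∧ ∫ ω, W k j ω ^ 2 ∂μ = _ := fun k j =>
    integral_sum_mul_output_sub_sq h hL η ζ hTT j (sum_eigenvectorBasis_mul_mulVec H k)
      (∑ i, H.eigenvectorBasis k i * avg r j)
  -- the constant mode
  have hzero : ∀ j, c ^ 2 * ∫ ω, W k₀ j ω ^ 2 ∂μ ≤ 2 * (⨆ i, σ i j ^ 2) / T := by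
    intro j
    rw [(hmom k₀ j).2, hk₀, mul_zero]
    have e1 : ∑ t ∈ Finset.Ico T₀ T, stepResponse 0 ζ t = m := by
      simp only [stepResponse_zero_mode, Finset.sum_const, Nat.card_Ico, nsmul_eq_mul, mul_one, hmN]
    -- In the constant mode the weights are 0 before T₀ and 1 afterwards.
    have e2 : ∑ s ∈ Finset.range T, modeWeight 0 ζ T₀ T s ^ 2 = m := by
      rw [← e1, ← sum_modeWeight 0 ζ hTT]
      refine Finset.sum_congr rfl fun s _ => ?_
      simp only [modeWeight, stepResponse_zero_mode]
      split_ifs <;> norm_num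
    have e3 : ∑ i, H.eigenvectorBasis k₀ i * r i j = ∑ i, H.eigenvectorBasis k₀ i * avg r j := by
      simp only [hc, avg, Pi.smul_apply, Finset.sum_apply, smul_eq_mul, ← Finset.mul_sum,
        Finset.sum_const, Finset.card_univ, Fintype.card_fin, nsmul_eq_mul]
      field_simp
    have e4 : ∑ i, σ i j ^ 2 ≤ N * ⨆ i, σ i j ^ 2 := by
      calc ∑ i, σ i j ^ 2 ≤ ∑ _i : Fin N, ⨆ i, σ i j ^ 2 :=
            Finset.sum_le_sum fun i _ => le_ciSup (Finite.bddAbove_range fun i => σ i j ^ 2) i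
        _ = _ := by simp
    have e5 : 0 ≤ ⨆ i, σ i j ^ 2 := Real.iSup_nonneg fun i => sq_nonneg _
    have e6 : c ^ 2 ≤ 1 := by
      have : (1 : ℝ) ≤ N := by exact_mod_cast (by omega : 1 ≤ N)
      nlinarith [sq_nonneg c]
    rw [e1, e2, inv_mul_cancel₀ hm0.ne', one_mul, e3, sub_self]
    simp only [hc, ← Finset.mul_sum]
    calc c ^ 2 * (0 ^ 2 + m⁻¹ ^ 2 * (m * (c ^ 2 * ∑ i, σ i j ^ 2)))
        = c ^ 2 * (c ^ 2 * ∑ i, σ i j ^ 2) / m := by field_simp; ring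
      _ ≤ c ^ 2 * (c ^ 2 * (N * ⨆ i, σ i j ^ 2)) / m := by gcongr
      _ = c ^ 2 * ((N * c ^ 2) * ⨆ i, σ i j ^ 2) / m := by ring
      _ ≤ 1 * ((N * c ^ 2) * ⨆ i, σ i j ^ 2) / m := by gcongr
      _ = (⨆ i, σ i j ^ 2) / m := by rw [hc1]; ring
      _ ≤ (⨆ i, σ i j ^ 2) / (T / 2) := by gcongr; linarith
      _ = _ := by field_simp
  -- the other modes
  set E := Real.exp (-(T : ℝ) / (2 * √κ)) with hE
  have hother : ∀ j, ∀ k ∈ Finset.univ.erase k₀, ∫ ω, W k j ω ^ 2 ∂μ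
      ≤ 64 * E ^ 2 * (∑ i, H.eigenvectorBasis k i * (r i j - avg r j)) ^ 2
        + 512 * √κ / T ^ 2 * ∑ i, H.eigenvectorBasis k i ^ 2 * σ i j ^ 2 := by
    intro j k hk
    obtain ⟨hs0, hlo, hup⟩ := hmodes k (Finset.ne_of_mem_erase hk)
    rw [← hq2] at hlo
    rw [(hmom k j).2]
    have e1 : ∑ i, H.eigenvectorBasis k i * (r i j - avg r j)
        = ∑ i, H.eigenvectorBasis k i * r i j := by
      simp only [mul_sub, Finset.sum_sub_distrib, ← Finset.sum_mul, hs0, zero_mul, sub_zero]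
    have e2 : ∑ i, H.eigenvectorBasis k i * avg r j = 0 := by
      rw [← Finset.sum_mul, hs0, zero_mul]
    have e3 := abs_sum_stepResponse_le hq0 hq1 hζq hlo hup (T₀ := T₀) (T := T) (by omega)
    have e4 := sum_stepResponse_sq_le hq0 hq1 hζq hlo hup T
    have e5 := sum_modeWeight_sq_le (η * H.eigenvalues k) ζ hTT
    have e6 : (1 - q) ^ T₀ ≤ 2 * E := by
      refine (one_sub_pow_half_le hq0 hq1 T).trans (le_of_eq ?_)
      rw [hE, hq]; congr 2; field_simp
    rw [e2, sub_zero, e1, mul_pow]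
    gcongr ?_ * _ + ?_
    · rw [hmN] at e3
      have e7 : |m⁻¹ * ∑ t ∈ Finset.Ico T₀ T, stepResponse (η * H.eigenvalues k) ζ t|
          -- The factor 4 comes from the averaged step response and 2 from the floor in T/2.
          ≤ 8 * E := by
        rw [abs_mul, abs_of_pos (inv_pos.2 hm0), inv_mul_le_iff₀ hm0]
        refine e3.trans ?_
        exact mul_le_mul_of_nonneg_left (by linarith) hm0.le
      rw [← sq_abs]
      calc _ ≤ (8 * E) ^ 2 := by gcongr
        _ = _ := by ring
    · have e8 : 0 ≤ ∑ i, H.eigenvectorBasis k i ^ 2 * σ i j ^ 2 :=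
        Finset.sum_nonneg fun i _ => by positivity
      rw [← mul_assoc]
      gcongr
      -- The sum of squared weights does not grow with T, so the factor 1/m² survives as 1/T²; and
      -- 512 = 2²·4·32.
      calc m⁻¹ ^ 2 * ∑ s ∈ Finset.range T, modeWeight (η * H.eigenvalues k) ζ T₀ T s ^ 2
          ≤ (2 / T) ^ 2 * (4 * (32 / q)) := by
            gcongr
            · rw [inv_le_comm₀ hm0 (by positivity), inv_div]; linarith
            · exact e5.trans (by gcongr)
        _ = _ := by rw [hq]; field_simp; norm_num
  -- Summing over j makes one variable dominate all agents and all states at once, so the maxima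
  -- cost no union bound.
  refine ⟨fun ω => ∑ j, (2 * (c ^ 2 * W k₀ j ω ^ 2)
      + 2 * ∑ k ∈ Finset.univ.erase k₀, W k j ω ^ 2), ?_, fun ω => ?_, fun ω i j => ?_, ?_⟩
  · exact integrable_finsetSum _ fun j _ => (((hmom k₀ j).1.const_mul _).const_mul _).add
      ((integrable_finsetSum _ fun k _ => (hmom k j).1).const_mul _)
  · exact Finset.sum_nonneg fun j _ => add_nonneg (by positivity)
      (mul_nonneg zero_le_two (Finset.sum_nonneg fun k _ => sq_nonneg _))
  · have h1 := sq_le_sum_sq_modes H hc (fun i => O ω i j - avg r j) i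
    have h2 : ∀ k, ∑ i', H.eigenvectorBasis k i' * (O ω i' j - avg r j) = W k j ω := fun k => by
      simp only [hW, mul_sub, Finset.sum_sub_distrib]
    simp only [h2] at h1
    refine h1.trans ?_
    exact Finset.single_le_sum (f := fun j => 2 * (c ^ 2 * W k₀ j ω ^ 2)
      + 2 * ∑ k ∈ Finset.univ.erase k₀, W k j ω ^ 2) (fun j _ => add_nonneg (by positivity)
      (mul_nonneg zero_le_two (Finset.sum_nonneg fun k _ => sq_nonneg _))) (Finset.mem_univ j)
  · have hi0 : ∀ j, Integrable (fun ω => 2 * (c ^ 2 * W k₀ j ω ^ 2)) μ := fun j =>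
      ((hmom k₀ j).1.const_mul _).const_mul _
    have hi1 : ∀ j, Integrable (fun ω => 2 * ∑ k ∈ Finset.univ.erase k₀, W k j ω ^ 2) μ := fun j =>
      (integrable_finsetSum _ fun k _ => (hmom k j).1).const_mul _
    have hsum : ∫ ω, ∑ j, (2 * (c ^ 2 * W k₀ j ω ^ 2)
        + 2 * ∑ k ∈ Finset.univ.erase k₀, W k j ω ^ 2) ∂μ
        = ∑ j, ∫ ω, (2 * (c ^ 2 * W k₀ j ω ^ 2)
        + 2 * ∑ k ∈ Finset.univ.erase k₀, W k j ω ^ 2) ∂μ :=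
      integral_finsetSum _ fun j _ => (hi0 j).add (hi1 j)
    refine hsum.le.trans ?_
    have hj : ∀ j, ∫ ω, (2 * (c ^ 2 * W k₀ j ω ^ 2)
        + 2 * ∑ k ∈ Finset.univ.erase k₀, W k j ω ^ 2) ∂μ
        ≤ 4 / T * (⨆ i, σ i j ^ 2) + 128 * E ^ 2 * ∑ i, (r i j - avg r j) ^ 2
          + 1024 * √κ / T ^ 2 * ∑ i, σ i j ^ 2 := by
      intro j
      rw [integral_add (hi0 j) (hi1 j), integral_const_mul, integral_const_mul, integral_const_mul,
        integral_finsetSum _ fun k _ => (hmom k j).1]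
      have f1 := hzero j
      have f2 : ∑ k ∈ Finset.univ.erase k₀, ∫ ω, W k j ω ^ 2 ∂μ
          ≤ 64 * E ^ 2 * ∑ i, (r i j - avg r j) ^ 2
            + 512 * √κ / T ^ 2 * ∑ i, σ i j ^ 2 := by
        calc _ ≤ ∑ k ∈ Finset.univ.erase k₀, (64 * E ^ 2
                  * (∑ i, H.eigenvectorBasis k i * (r i j - avg r j)) ^ 2
                + 512 * √κ / T ^ 2 * ∑ i, H.eigenvectorBasis k i ^ 2 * σ i j ^ 2) :=
              Finset.sum_le_sum (hother j)
          _ ≤ ∑ k, (64 * E ^ 2 * (∑ i, H.eigenvectorBasis k i * (r i j - avg r j)) ^ 2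
                + 512 * √κ / T ^ 2 * ∑ i, H.eigenvectorBasis k i ^ 2 * σ i j ^ 2) := by
              refine Finset.sum_le_sum_of_subset_of_nonneg (Finset.erase_subset _ _)
                fun k _ _ => ?_
              have : 0 ≤ ∑ i, H.eigenvectorBasis k i ^ 2 * σ i j ^ 2 :=
                Finset.sum_nonneg fun i _ => by positivity
              positivity
          -- Parseval in k handles the bias. For the noise, the squared i-th coordinates of the
          -- eigenbasis sum to 1.
          _ = _ := by
              rw [Finset.sum_add_distrib, ← Finset.mul_sum, ← Finset.mul_sum,
                sum_sq_modes H (fun i => r i j - avg r j), Finset.sum_comm]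
              simp only [← Finset.sum_mul, sum_sq_eigenvectorBasis_apply, one_mul]
      have f3 : 2 * (2 * (⨆ i, σ i j ^ 2) / T) = 4 / T * (⨆ i, σ i j ^ 2) := by ring
      have f4 : 2 * (512 * √κ / T ^ 2 * ∑ i, σ i j ^ 2)
          = 1024 * √κ / T ^ 2 * ∑ i, σ i j ^ 2 := by ring
      linarith
    refine (Finset.sum_le_sum fun j _ => hj j).trans (le_of_eq ?_)
    rw [Finset.sum_add_distrib, Finset.sum_add_distrib, ← Finset.mul_sum, ← Finset.mul_sum,
      ← Finset.mul_sum, Finset.sum_comm (f := fun i j => (r i j - avg r j) ^ 2),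
      Finset.sum_comm (f := fun i j => σ i j ^ 2)]
    ring

end TunedOutput

end SDA

/-- Decentralized policy evaluation: the plug-in estimates built from the outputs of the tuned
algorithm and the empirical transition matrix. The constant `C` is absolute. `‖·‖` on
`Fin n → ℝ` is the sup norm. -/
theorem mainTheorem3 :
    ∃ C : ℝ, 0 < C ∧
      ∀ (N n : ℕ) (hN : 2 ≤ N) (G : SimpleGraph (Fin N)) [DecidableRel G.Adj]
        (L : Matrix (Fin N) (Fin N) ℝ) (P : Matrix (Fin n) (Fin n) ℝ)
        (γ rmax : ℝ) (r σ : Fin N → Fin n → ℝ)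
        (Ω : Type*) [MeasurableSpace Ω] (μ : Measure Ω) [IsProbabilityMeasure μ]
        (X : ℕ → Fin n → Ω → Fin n) (R : Fin N → ℕ → Ω → Fin n → ℝ) (T : ℕ),
        G.Connected →
        ∀ (hL : SDA.IsGossipMatrix G L) (hP : P ∈ Matrix.rowStochastic ℝ (Fin n)),
        0 ≤ γ → γ < 1 →
        (∀ j, |SDA.avg r j| ≤ rmax) →
        SDA.IsGenerativeModel μ P r σ X R →
        1 ≤ T →
        let κ : ℝ := SDA.kappa hL.posSemidef.isHermitian hN
        let J : Fin n → ℝ := SDA.valueFunction hP γ (SDA.avg r)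
        let Jhat : Fin N → Ω → Fin n → ℝ := fun i ω =>
          SDA.plugIn γ (SDA.empiricalP (fun t j => X t j ω) T)
            (SDA.tunedOutput G hL.posSemidef.isHermitian hN (fun i t => R i t ω) T i)
        Integrable (fun ω => ⨆ i, ‖Jhat i ω - J‖) μ ∧
        ∫ ω, ⨆ i, ‖Jhat i ω - J‖ ∂μ ≤
          C * (Real.exp (-(T : ℝ) / (2 * Real.sqrt κ)) *
                  (Real.sqrt (∑ i, ∑ j, (r i j - SDA.avg r j) ^ 2) / (1 - γ))
              + κ ^ (1 / 4 : ℝ) * Real.sqrt (∑ i, ∑ j, σ i j ^ 2) / ((1 - γ) * T)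
              + Real.sqrt (∑ j, ⨆ i, σ i j ^ 2) / ((1 - γ) * Real.sqrt T)
              + rmax * Real.sqrt (Real.log n) / ((1 - γ) ^ (3 / 2 : ℝ) * Real.sqrt T)
              + rmax * Real.log n / ((1 - γ) ^ 2 * T)) := by
  refine ⟨100, by norm_num, ?_⟩
  intro N n hN G _ L P γ rmax r σ Ω _ μ _ X R T _ hL hP hγ hγ1 hr hgen hT κ J Jhat
  have hg : 0 < 1 - γ := by linarith
  have hT0 : (0 : ℝ) < T := by positivity
  have hN' : Nonempty (Fin N) := ⟨⟨0, by omega⟩⟩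
  have hκ : 1 ≤ κ := (SDA.exists_consensus_mode hL hN).1
  obtain ⟨D, hDi, hD0, hDle, hDe⟩ := SDA.exists_sq_error_bound hgen hL hN hT
  obtain ⟨hSi, hSe⟩ := SDA.integral_sqrt_le hDi hD0
  set B := ∑ i, ∑ j, (r i j - SDA.avg r j) ^ 2
  set V := ∑ i, ∑ j, σ i j ^ 2
  set S := ∑ j, ⨆ i, σ i j ^ 2
  set E := Real.exp (-(T : ℝ) / (2 * √κ))
  have hB : 0 ≤ B := Finset.sum_nonneg fun i _ => Finset.sum_nonneg fun j _ => sq_nonneg _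
  have hV : 0 ≤ V := Finset.sum_nonneg fun i _ => Finset.sum_nonneg fun j _ => sq_nonneg _
  have hS : 0 ≤ S := Finset.sum_nonneg fun j _ => Real.iSup_nonneg fun i => sq_nonneg _
  have hE : 0 < E := Real.exp_pos _
  have hκ4 : (κ ^ (1 / 4 : ℝ)) ^ 2 = √κ := by
    rw [← Real.rpow_natCast, ← Real.rpow_mul (by linarith), Real.sqrt_eq_rpow]; norm_num
  have hκ0 : 0 ≤ κ ^ (1 / 4 : ℝ) := Real.rpow_nonneg (by linarith) _
  -- The coefficients are square roots: 12² ≥ 128, 32² = 1024, 2² = 4. With the 100 of the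
  -- transition part they fix the absolute constant.
  have hroot : √(∫ ω, D ω ∂μ)
      ≤ 12 * (E * √B) + 32 * (κ ^ (1 / 4 : ℝ) * √V / T) + 2 * (√S / √T) := by
    refine Real.sqrt_le_iff.2 ⟨by positivity, hDe.trans ?_⟩
    have e1 : (E * √B) ^ 2 = E ^ 2 * B := by rw [mul_pow, Real.sq_sqrt hB]
    have e2 : (κ ^ (1 / 4 : ℝ) * √V / T) ^ 2 = √κ * V / T ^ 2 := by
      rw [div_pow, mul_pow, Real.sq_sqrt hV, hκ4]
    have e3 : (√S / √T) ^ 2 = S / T := by rw [div_pow, Real.sq_sqrt hS, Real.sq_sqrt hT0.le]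
    have p1 : 0 ≤ E * √B := by positivity
    have p2 : 0 ≤ κ ^ (1 / 4 : ℝ) * √V / T := by positivity
    have p3 : 0 ≤ √S / √T := by positivity
    have e4 : 1024 * √κ * V / T ^ 2 = 1024 * (√κ * V / T ^ 2) := by ring
    have e5 : 4 * S / T = 4 * (S / T) := by ring
    rw [e4, e5, mul_assoc 128, ← e1, ← e2, ← e3]
    nlinarith [mul_nonneg p1 p2, mul_nonneg p1 p3, mul_nonneg p2 p3, sq_nonneg (E * √B)]
  set A : Ω → Matrix (Fin n) (Fin n) ℝ := fun ω => SDA.empiricalP (fun t j => X t j ω) T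
  have hA : ∀ ω, A ω ∈ Matrix.rowStochastic ℝ (Fin n) := fun ω =>
    SDA.empiricalP_mem_rowStochastic _ hT
  have hAm : ∀ i j, Measurable fun ω => A ω i j := SDA.measurable_empiricalP hgen.measurable_next T
  set Δ : Ω → ℝ := fun ω => ‖SDA.plugIn γ (A ω) (SDA.avg r) - J‖
  have hΔi : Integrable Δ μ := by
    refine SDA.integrable_of_abs_le (K := ‖SDA.avg r‖ / (1 - γ) + ‖J‖)
      ((SDA.measurable_plugIn γ hAm measurable_const).sub_const J).norm fun ω => ?_
    rw [abs_of_nonneg (norm_nonneg _)]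
    refine (norm_sub_le _ _).trans ?_
    gcongr
    exact SDA.norm_plugIn_le (hA ω) hγ hγ1 _
  have hΔe := SDA.integral_norm_plugIn_sub_le hP hγ hγ1 hgen.measurable_next hgen.law_next
    hgen.indep_next hT hr
  -- The transition error Δ is common to all agents, so the maximum over i affects only the reward
  -- error.
  have hdom : ∀ ω, ⨆ i, ‖Jhat i ω - J‖ ≤ √(D ω) / (1 - γ) + Δ ω := by
    intro ω
    refine ciSup_le fun i => ?_
    have e1 : Jhat i ω - J = SDA.plugIn γ (A ω)
        (SDA.tunedOutput G hL.posSemidef.isHermitian hN (fun i t => R i t ω) T i - SDA.avg r)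
        + (SDA.plugIn γ (A ω) (SDA.avg r) - J) := by
      rw [SDA.plugIn_sub]; abel
    rw [e1]
    refine (norm_add_le _ _).trans (add_le_add ((SDA.norm_plugIn_le (hA ω) hγ hγ1 _).trans ?_) le_rfl)
    gcongr
    refine (pi_norm_le_iff_of_nonneg (Real.sqrt_nonneg _)).2 fun j => ?_
    exact Real.abs_le_sqrt (hDle ω i j)
  have hmeas : Measurable fun ω => ⨆ i, ‖Jhat i ω - J‖ :=
    Measurable.iSup fun i => ((SDA.measurable_plugIn γ hAm
      (SDA.measurable_output hgen.measurable_reward _ _ _ _ i)).sub_const J).norm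
  have hdi : Integrable (fun ω => √(D ω) / (1 - γ) + Δ ω) μ := (hSi.div_const _).add hΔi
  have hint : Integrable (fun ω => ⨆ i, ‖Jhat i ω - J‖) μ := by
    refine hdi.mono' hmeas.aestronglyMeasurable (Filter.Eventually.of_forall fun ω => ?_)
    rw [Real.norm_of_nonneg (Real.iSup_nonneg fun i => norm_nonneg _)]
    exact hdom ω
  refine ⟨hint, (integral_mono hint hdi hdom).trans ?_⟩
  rw [integral_add (hSi.div_const _) hΔi, integral_div]
  have hfirst : (∫ ω, √(D ω) ∂μ) / (1 - γ)
      ≤ 12 * (E * (√B / (1 - γ))) + 32 * (κ ^ (1 / 4 : ℝ) * √V / ((1 - γ) * T))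
        + 2 * (√S / ((1 - γ) * √T)) := by
    calc _ ≤ (12 * (E * √B) + 32 * (κ ^ (1 / 4 : ℝ) * √V / T) + 2 * (√S / √T)) / (1 - γ) := by
          gcongr; exact hSe.trans hroot
      _ = _ := by field_simp
  have p1 : 0 ≤ E * (√B / (1 - γ)) := by positivity
  have p2 : 0 ≤ κ ^ (1 / 4 : ℝ) * √V / ((1 - γ) * T) := by positivity
  have p3 : 0 ≤ √S / ((1 - γ) * √T) := by positivity
  linarith
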